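/- **Theorem (Eternal block-diagonal approximation).** Let $H$ be a (possibly unbounded) self-adjoint operator with domain $D(H)$ on a complex Hilbert space $\mathcal H$, with pure point spectrum, i.e. its eigenvectors span a dense subspace of $\mathcal H$. Let $\{h_k\}_{k\ge 1}$ be its distinct eigenvalues, and assume that its minimal spectral gap does not vanish: $$\eta=\inf_{k\neq \ell}|h_k-h_\ell|>0$$ (with $\eta=+\infty$ if there are no two distinct eigenvalues). For each $\varepsilon\in[0,1]$ let $V(\varepsilon)$ be a bounded self-adjoint operator on $\mathcal H$, and assume that $$v=\sup_{\varepsilon\in[0,1]}\|V(\varepsilon)\|<+\infty .$$ Let $\alpha>0$ be the unique positive solution of $(\alpha+1)(e^{2/\alpha}-1)=3$, and set $$\beta=\frac{16\pi\alpha}{\sqrt3}\bigl(e^{\frac1{2\alpha}}-1\bigr),\qquad \rho=\frac{4\pi\alpha}{\sqrt3}.$$ Let $\{H\}'$ denote the commutant of $H$, i.e. the set of bounded operators on $\mathcal H$ that commute with all spectral projections $P_H(\Omega)$, $\Omega\subset\mathbb R$ Borel. Then there exists a family of bounded operators $\hat V(\varepsilon)$, $\varepsilon\in[0,1]$, such that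 1. $\hat V(\varepsilon)=\hat V(\varepsilon)^\dagger\in\{H\}'$ for all $\varepsilon\in[0,1]$; 2. for all $\varepsilon\in[0,1]$ with $\varepsilon\le \dfrac{\eta}{v\rho}$ (no further restriction on $\varepsilon$ if $v=0$ or $\eta=+\infty$) and all $t\in\mathbb R$, $$\bigl\|e^{-it(H+\varepsilon V(\varepsilon))}-e^{-it(H+\varepsilon \hat V(\varepsilon))}\bigr\|\le\frac{\beta}{2}\,\frac{v}{\eta}\,\varepsilon$$ (the right-hand side being $0$ if $\eta=+\infty$). Here $H+\varepsilon V(\varepsilon)$ and $H+\varepsilon\hat V(\varepsilon)$ have domain $D(H)$, and $e^{-itA}$ is the strongly continuous one-parameter unitary group generated by the self-adjoint operator $A$. -/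

import Mathlib

open scoped ENNReal

noncomputable section

namespace EternalApprox

variable {E : Type*} [NormedAddCommGroup E] [InnerProductSpace ℂ E]

/-! ### Spectral notions for an operator with pure point spectrum -/

/-- The eigenspace `{ψ ∈ D(H) | H ψ = h ψ}` of an unbounded operator `H`, for a real number `h`. -/
def eigenspace (H : E →ₗ.[ℂ] E) (h : ℝ) : Submodule ℂ E where
  carrier := {ψ | (ψ, (h : ℂ) • ψ) ∈ H.graph}
  add_mem' {a b} ha hb := by
    have := H.graph.add_mem ha hb
    simpa [smul_add] using this
  zero_mem' := by
    change ((0 : E), (h : ℂ) • (0 : E)) ∈ H.graph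
    rw [smul_zero]
    exact H.graph.zero_mem
  smul_mem' c a ha := by
    have := H.graph.smul_mem c ha
    rwa [Prod.smul_mk, smul_comm c (h : ℂ) a] at this

/-- The set `{h_k}` of the eigenvalues of `H` (they are real when `H` is self-adjoint). -/
def eigenvalues (H : E →ₗ.[ℂ] E) : Set ℝ := {h | eigenspace H h ≠ ⊥}

/-- `H` has pure point spectrum: its eigenvectors span a dense subspace, so that (when `H` is
self-adjoint) there is an orthonormal basis of eigenvectors. -/
def HasPurePointSpectrum (H : E →ₗ.[ℂ] E) : Prop :=
  (⨆ h : ℝ, eigenspace H h).topologicalClosure = ⊤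

/-- The minimal spectral gap `η = inf_{k ≠ ℓ} |h_k - h_ℓ|`, as an element of `[0, ∞]`
(it is `∞` if there are no two distinct eigenvalues). -/
def spectralGap (H : E →ₗ.[ℂ] E) : ℝ≥0∞ :=
  ⨅ h ∈ eigenvalues H, ⨅ k ∈ eigenvalues H, ⨅ _ : h ≠ k, ENNReal.ofReal |h - k|

/-- The spectral projection `P_H(Ω)` of a self-adjoint operator `H` with pure point spectrum:
`P_H(Ω) = ∑_{h_k ∈ Ω} P_k`, the orthogonal projection onto the closed span of the eigenspaces
of the eigenvalues that lie in `Ω`. -/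
def spectralProjection [CompleteSpace E] (H : E →ₗ.[ℂ] E) (Ω : Set ℝ) : E →L[ℂ] E :=
  (⨆ h ∈ Ω, eigenspace H h).topologicalClosure.starProjection

/-- The commutant `{H}'` of a self-adjoint operator `H` with pure point spectrum: the bounded
operators that commute with all the spectral projections of `H`. -/
def commutant [CompleteSpace E] (H : E →ₗ.[ℂ] E) : Set (E →L[ℂ] E) :=
  {S | ∀ Ω : Set ℝ, MeasurableSet Ω → Commute S (spectralProjection H Ω)}

/-! ### Perturbations and dynamics -/

/-- The operator `H + B`, with domain `D(H)`, for a bounded operator `B`. -/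
def addBounded (H : E →ₗ.[ℂ] E) (B : E →L[ℂ] E) : E →ₗ.[ℂ] E where
  domain := H.domain
  toFun := H.toFun + (B : E →ₗ[ℂ] E).comp H.domain.subtype

/-- The uniform bound `v = sup_{ε ∈ [0,1]} ‖V(ε)‖` of a family of bounded operators, as an
element of `[0, ∞]`. -/
def uniformBound (V : Set.Icc (0 : ℝ) 1 → (E →L[ℂ] E)) : ℝ≥0∞ := ⨆ ε, ‖V ε‖ₑ

/-- `U(t) = e^{-itA}` for all `t`: `U` is a strongly continuous one-parameter group of unitary
operators and `A` is its generator, i.e. `ψ ∈ D(A)` with `A ψ = φ` if and only if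
`t ↦ U(t) ψ` is differentiable at `0` with derivative `-i φ`. By Stone's theorem there is
exactly one such group for each self-adjoint `A`. -/
structure IsEvolution [CompleteSpace E] (A : E →ₗ.[ℂ] E) (U : ℝ → (E →L[ℂ] E)) : Prop where
  mem_unitary : ∀ t, U t ∈ unitary (E →L[ℂ] E)
  map_zero : U 0 = 1
  map_add : ∀ s t, U (s + t) = U s * U t
  continuous : ∀ ψ, Continuous fun t => U t ψ
  generator : ∀ ψ φ, (ψ, φ) ∈ A.graph ↔ HasDerivAt (fun t => U t ψ) (-(Complex.I • φ)) 0

theorem IsEvolution.hasDerivAt [CompleteSpace E] {A : E →ₗ.[ℂ] E} {U : ℝ → (E →L[ℂ] E)}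
    (hU : IsEvolution A U) {ψ φ : E} (h : (ψ, φ) ∈ A.graph) (t : ℝ) :
    (U t ψ, U t φ) ∈ A.graph ∧ HasDerivAt (fun s => U s ψ) (-(Complex.I • U t φ)) t := by
  have h0 := (hU.generator ψ φ).1 h
  have h1 : HasDerivAt (fun s => U t (U s ψ)) (-(Complex.I • U t φ)) 0 := by
    have := ((U t).restrictScalars ℝ).hasFDerivAt.comp_hasDerivAt (0 : ℝ) h0
    simpa [Function.comp_def] using this
  constructor
  · rw [hU.generator]
    convert h1 using 2 with s
    rw [← mul_apply_eq_comp, ← mul_apply_eq_comp, ← hU.map_add,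
      ← hU.map_add, add_comm]
  · have h2 : HasDerivAt (fun s => U t (U s ψ)) (-(Complex.I • U t φ)) (t - t) := by
      simpa using h1
    have h3 := h2.comp_sub_const t t
    convert h3 using 2 with s
    rw [← mul_apply_eq_comp, ← hU.map_add]
    simp

/-- A self-adjoint operator generates at most one unitary group, so that `IsEvolution A U`
determines `U`. -/
theorem IsEvolution.unique [CompleteSpace E] {A : E →ₗ.[ℂ] E} (hA : IsSelfAdjoint A)
    {U U' : ℝ → (E →L[ℂ] E)} (hU : IsEvolution A U) (hU' : IsEvolution A U') : U = U' := by
  have hdense := hA.dense_domain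
  have hsymm : ∀ x y : A.domain, inner ℂ (A x) (y : E) = inner ℂ (x : E) (A y) := by
    have h := LinearPMap.adjoint_isFormalAdjoint hdense
    rw [LinearPMap.isSelfAdjoint_def.1 hA] at h
    exact h
  have hnorm : ∀ {W : ℝ → (E →L[ℂ] E)}, IsEvolution A W → ∀ t (x : E),
      inner ℂ (W t x) (W t x) = inner ℂ x x := by
    intro W hW t x
    have h := (Unitary.mem_iff.1 (hW.mem_unitary t)).1
    rw [← ContinuousLinearMap.adjoint_inner_right, ← ContinuousLinearMap.star_eq_adjoint,
      ← mul_apply_eq_comp, h, one_apply_eq_self]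
  funext t
  have key : ∀ x ∈ (A.domain : Set E), U t x = U' t x := by
    intro x hx
    have hg : (x, A ⟨x, hx⟩) ∈ A.graph := by
      rw [LinearPMap.mem_graph_iff]; exact ⟨⟨x, hx⟩, rfl, rfl⟩
    have hconst : ∀ s, HasDerivAt (fun s => inner ℂ (U s x) (U' s x)) (0 : ℂ) s := by
      intro s
      obtain ⟨g1, d1⟩ := hU.hasDerivAt hg s
      obtain ⟨g2, d2⟩ := hU'.hasDerivAt hg s
      have hd := d1.inner ℂ d2
      refine hd.congr_deriv ?_
      rw [LinearPMap.mem_graph_iff] at g1 g2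
      obtain ⟨y1, e1, f1⟩ := g1
      obtain ⟨y2, e2, f2⟩ := g2
      simp only at e1 f1 e2 f2
      rw [← e1, ← f1, ← e2, ← f2]
      simp [inner_neg_left, inner_neg_right, inner_smul_left, inner_smul_right, hsymm]
    have hc := is_const_of_deriv_eq_zero (fun s => (hconst s).differentiableAt)
      (fun s => (hconst s).deriv) t 0
    simp only [hU.map_zero, hU'.map_zero, one_apply_eq_self] at hc
    have hc' : inner ℂ (U' t x) (U t x) = inner ℂ x x := by
      rw [← inner_conj_symm, hc, inner_conj_symm]
    rw [← sub_eq_zero, ← inner_self_eq_zero (𝕜 := ℂ), inner_sub_left, inner_sub_right,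
      inner_sub_right, hc, hc', hnorm hU, hnorm hU']
    simp
  exact ContinuousLinearMap.ext fun x => congrFun
    (Continuous.ext_on hdense (U t).continuous (U' t).continuous key) x

/-! ### The constants -/

theorem existsUnique_alpha : ∃! α : ℝ, 0 < α ∧ (α + 1) * (Real.exp (2 / α) - 1) = 3 := by
  have hconv : StrictConvexOn ℝ (Set.Ici (0 : ℝ))
      (fun u : ℝ => (2 + u) * (Real.exp u - 1) - 3 * u) := by
    have hd : ∀ u : ℝ, HasDerivAt (fun u : ℝ => (2 + u) * (Real.exp u - 1) - 3 * u)
        ((3 + u) * Real.exp u - 4) u := by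
      intro u
      have := (((hasDerivAt_id u).const_add 2).mul ((Real.hasDerivAt_exp u).sub_const 1)).sub
        ((hasDerivAt_id u).const_mul 3)
      refine this.congr_deriv ?_
      simp only [id]
      ring
    refine StrictMonoOn.strictConvexOn_of_deriv (convex_Ici 0)
      (fun u _ => (hd u).continuousAt.continuousWithinAt) ?_
    intro x hx y hy hxy
    rw [interior_Ici] at hx hy
    rw [(hd x).deriv, (hd y).deriv]
    have h1 : Real.exp x < Real.exp y := Real.exp_lt_exp.2 hxy
    have h2 := Real.exp_pos x
    have hx' : 0 < x := hx
    nlinarith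
  have hiff : ∀ α : ℝ, 0 < α → (α + 1) * (Real.exp (2 / α) - 1) = 3 →
      (2 + 2 / α) * (Real.exp (2 / α) - 1) - 3 * (2 / α) = 0 := by
    intro α hα h
    have : (2 + 2 / α) = (2 / α) * (α + 1) := by field_simp
    rw [this, mul_assoc, h]; ring
  have hlt : ∀ a b : ℝ, 0 < a → a < b →
      (2 + a) * (Real.exp a - 1) - 3 * a = 0 → (2 + b) * (Real.exp b - 1) - 3 * b = 0 → False := by
    intro a b ha hab h1 h2
    have hb : 0 < b := ha.trans hab
    have h := hconv.2 (show (0 : ℝ) ∈ Set.Ici 0 by simp) (show b ∈ Set.Ici 0 from hb.le) hb.ne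
      (show 0 < 1 - a / b by rw [sub_pos, div_lt_one hb]; exact hab)
      (div_pos ha hb) (by ring)
    have e : (1 - a / b) • (0 : ℝ) + (a / b) • b = a := by
      simp only [smul_eq_mul]; field_simp; ring
    rw [e] at h
    simp only [smul_eq_mul] at h
    rw [h1, h2] at h
    simp at h
  have hex : ∃ α ∈ Set.Icc (2 : ℝ) 20, (α + 1) * (Real.exp (2 / α) - 1) = 3 := by
    have hc : ContinuousOn (fun α : ℝ => (α + 1) * (Real.exp (2 / α) - 1)) (Set.Icc 2 20) := by
      intro x hx
      have : x ≠ 0 := by have := hx.1; linarith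
      apply ContinuousAt.continuousWithinAt
      fun_prop (disch := assumption)
    refine intermediate_value_Icc' (by norm_num) hc ⟨?_, ?_⟩
    · have h := Real.exp_bound_div_one_sub_of_interval (x := 2 / 20) (by norm_num) (by norm_num)
      norm_num at h ⊢
      linarith
    · have h := Real.add_one_le_exp (1 : ℝ)
      norm_num at h ⊢
      linarith
  obtain ⟨α, hα, he⟩ := hex
  have hα0 : 0 < α := by have := hα.1; linarith
  refine ⟨α, ⟨hα0, he⟩, ?_⟩
  rintro γ ⟨hγ0, hγ⟩
  have e1 := hiff α hα0 he
  have e2 := hiff γ hγ0 hγ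
  rcases lt_trichotomy γ α with h | h | h
  · exact (hlt _ _ (by positivity) (div_lt_div_of_pos_left two_pos hγ0 h) e1 e2).elim
  · exact h
  · exact (hlt _ _ (by positivity) (div_lt_div_of_pos_left two_pos hα0 h) e2 e1).elim

/-- `α ≈ 4.79`, the unique positive solution of `(α + 1)(e^{2/α} - 1) = 3`. -/
def constAlpha : ℝ := existsUnique_alpha.choose

theorem constAlpha_spec :
    0 < constAlpha ∧ (constAlpha + 1) * (Real.exp (2 / constAlpha) - 1) = 3 :=
  existsUnique_alpha.choose_spec.1

/-- `β = (16πα/√3)(e^{1/(2α)} - 1) ≈ 15.3`. -/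
def constBeta : ℝ :=
  16 * Real.pi * constAlpha / Real.sqrt 3 * (Real.exp (1 / (2 * constAlpha)) - 1)

/-- `ρ = 4πα/√3 ≈ 34.8`. -/
def constRho : ℝ := 4 * Real.pi * constAlpha / Real.sqrt 3

end EternalApprox

end

/-!
The perturbed operator `H + V` (with `ε` absorbed into `V`) is unitarily equivalent to a
block-diagonal operator `H + B` through a unitary `W` that is close to the identity. Since
`e^{-it(H + V)} = W e^{-it(H + B)} W†`, the two evolutions differ by at most `2 ‖W - 1‖`, uniformly
in time (`norm_conj_sub_le`).

The unitary is found in two steps. First one solves the Bloch equation `(H + V) Ω = Ω (H + B₀)` with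
`Ω = 1 + Y`, `Y` off-diagonal and `B₀` the block-diagonal part of `V Ω`. It is the fixed-point
equation `Y = Γ(Y B₀ - V Ω)`, where `Γ` inverts the commutator with `H` on off-diagonal operators,
and the right-hand side is a contraction of a small ball (`exists_waveOperator`). Then `Ω` is
replaced by the unitary part `W = Ω Z^{-1/2}` of its polar decomposition, where `Z = Ω† Ω`. Indeed
`[H, Z] = Z B₀ - B₀† Z`, so that the off-diagonal part of `Z` solves a homogeneous linear equation
with the unique solution zero (`commute_of_hasCommutator`). Hence `Z` is block-diagonal,
`B = Z^{1/2} B₀ Z^{-1/2}` is block-diagonal as well, and it is self-adjoint because `Z B₀ = B₀† Z`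
(`exists_unitary_blockDiagonal`).

The constants come from the norm of `Γ`, which multiplies the block `Pₖ A Pₗ` by `(hₖ - hₗ)⁻¹`.
A Schur multiplier whose rows are bounded by `C` in `ℓ²` has norm at most `C` (`exists_schur`), and
for eigenvalues with gap `η` the sum of `(hₖ - hₗ)⁻²` over `l` is at most `2 ζ(2) / η²`, which gives
`C = π / (√3 η)` (`exists_inverseCommutator`). One obtains `‖W - 1‖ ≤ 2 C ‖V‖`, provided that
`C ‖V‖ ≤ 1/8`; both `2 π / √3 ≤ β / 4` and `8 π / √3 ≤ ρ` hold, the latter because `α ≥ 2`.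

An operator with pure point spectrum is described through the projections onto its eigenspaces:
`H ψ = φ` if and only if `Pᵢ φ = h(i) Pᵢ ψ` for all `i` (`IsDiagonalization`). All statements about
domains reduce to this description, and the unitary groups are constructed explicitly from
`e^{-itH} = ∑ᵢ e^{-ith(i)} Pᵢ`, so that no theorem of Stone or Kato–Rellich is needed.
-/

namespace EternalApprox

/-! ### Orthogonal resolutions of the identity and Schur multipliers -/

section

variable {E : Type*} [NormedAddCommGroup E] [InnerProductSpace ℂ E]

/-- A family of mutually orthogonal projections that sums strongly to the identity. -/
structure IsResolution [CompleteSpace E] {ι : Type*} (P : ι → (E →L[ℂ] E)) : Prop where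
  isSelfAdjoint : ∀ i, IsSelfAdjoint (P i)
  mul_self : ∀ i, P i * P i = P i
  mul_of_ne : ∀ i j, i ≠ j → P i * P j = 0
  hasSum : ∀ ψ, HasSum (fun i => P i ψ) ψ

/-- If `ψ ↦ (R i ψ)ᵢ` is a contraction into `ℓ²(ι, E)` and `φ ↦ (L i† φ)ᵢ` is bounded by `C`, then
`∑ᵢ L i A R i` converges strongly to an operator of norm at most `C ‖A‖`. -/
theorem exists_hasSum_mul_mul [CompleteSpace E] {ι : Type*} (L R : ι → (E →L[ℂ] E))
    {C : ℝ} (hC : 0 ≤ C)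
    (hL : ∀ (F : Finset ι) φ, ∑ i ∈ F, ‖star (L i) φ‖ ^ 2 ≤ C ^ 2 * ‖φ‖ ^ 2)
    (hR : ∀ (F : Finset ι) ψ, ∑ i ∈ F, ‖R i ψ‖ ^ 2 ≤ ‖ψ‖ ^ 2) (A : E →L[ℂ] E) :
    ∃ T : E →L[ℂ] E, ‖T‖ ≤ C * ‖A‖ ∧ ∀ ψ, HasSum (fun i => L i (A (R i ψ))) (T ψ) := by
  have key : ∀ (F : Finset ι) ψ, ‖∑ i ∈ F, L i (A (R i ψ))‖ ≤
      C * ‖A‖ * √(∑ i ∈ F, ‖R i ψ‖ ^ 2) := by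
    intro F ψ
    -- Cauchy–Schwarz for `⟪φ, φ⟫ = ∑ ⟪L i† φ, A R i ψ⟫`
    set φ := ∑ i ∈ F, L i (A (R i ψ)) with hφ
    have h1 : ‖φ‖ ^ 2 ≤ ∑ i ∈ F, ‖star (L i) φ‖ * (‖A‖ * ‖R i ψ‖) := by
      have : (inner ℂ φ φ : ℂ) = ∑ i ∈ F, inner ℂ (star (L i) φ) (A (R i ψ)) := by
        conv_lhs => rw [hφ, inner_sum, ← hφ]
        refine Finset.sum_congr rfl fun i _ => ?_
        rw [ContinuousLinearMap.star_eq_adjoint, ContinuousLinearMap.adjoint_inner_left]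
      have h2 : ‖φ‖ ^ 2 = ‖(inner ℂ φ φ : ℂ)‖ := by
        rw [inner_self_eq_norm_sq_to_K]; simp
      rw [h2, this]
      refine (norm_sum_le _ _).trans (Finset.sum_le_sum fun i _ => ?_)
      exact (norm_inner_le_norm _ _).trans
        (mul_le_mul_of_nonneg_left (A.le_opNorm _) (norm_nonneg _))
    have h3 : ∑ i ∈ F, ‖star (L i) φ‖ * (‖A‖ * ‖R i ψ‖) ≤
        ‖A‖ * (√(∑ i ∈ F, ‖star (L i) φ‖ ^ 2) * √(∑ i ∈ F, ‖R i ψ‖ ^ 2)) := by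
      have := Real.sum_mul_le_sqrt_mul_sqrt F (fun i => ‖star (L i) φ‖) (fun i => ‖R i ψ‖)
      refine le_trans (le_of_eq ?_) (mul_le_mul_of_nonneg_left this (norm_nonneg A))
      rw [Finset.mul_sum]
      exact Finset.sum_congr rfl fun i _ => by ring
    have h4 : √(∑ i ∈ F, ‖star (L i) φ‖ ^ 2) ≤ C * ‖φ‖ := by
      rw [Real.sqrt_le_left (by positivity), mul_pow]
      exact hL F φ
    have h5 : ‖φ‖ * ‖φ‖ ≤ ‖φ‖ * (C * ‖A‖ * √(∑ i ∈ F, ‖R i ψ‖ ^ 2)) := by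
      calc ‖φ‖ * ‖φ‖ = ‖φ‖ ^ 2 := by ring
        _ ≤ _ := h1.trans h3
        _ ≤ ‖A‖ * (C * ‖φ‖ * √(∑ i ∈ F, ‖R i ψ‖ ^ 2)) := by gcongr
        _ = _ := by ring
    rcases (norm_nonneg φ).eq_or_lt with h | h
    · rw [← h]; positivity
    · exact le_of_mul_le_mul_left h5 h
  have hsum : ∀ ψ, Summable (fun i => L i (A (R i ψ))) := by
    intro ψ
    have hs : Summable (fun i => ‖R i ψ‖ ^ 2) :=
      summable_of_sum_le (fun i => by positivity) (fun F => hR F ψ)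
    rw [summable_iff_vanishing_norm]
    intro ε hε
    have hpos : 0 < C * ‖A‖ + 1 := by positivity
    obtain ⟨s, hs⟩ := summable_iff_vanishing_norm.1 hs ((ε / (C * ‖A‖ + 1)) ^ 2) (by positivity)
    refine ⟨s, fun t ht => ?_⟩
    have h1 := hs t ht
    rw [Real.norm_of_nonneg (Finset.sum_nonneg fun i _ => by positivity)] at h1
    have h2 : √(∑ i ∈ t, ‖R i ψ‖ ^ 2) < ε / (C * ‖A‖ + 1) := by
      rw [Real.sqrt_lt' (by positivity)]; exact h1
    calc _ ≤ C * ‖A‖ * √(∑ i ∈ t, ‖R i ψ‖ ^ 2) := key t ψ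
      _ ≤ (C * ‖A‖ + 1) * √(∑ i ∈ t, ‖R i ψ‖ ^ 2) := by gcongr; linarith
      _ < (C * ‖A‖ + 1) * (ε / (C * ‖A‖ + 1)) := by gcongr
      _ = ε := by field_simp
  let T : E →ₗ[ℂ] E :=
    { toFun := fun ψ => ∑' i, L i (A (R i ψ))
      map_add' := fun x y => by
        simp only [map_add]
        exact (hsum x).tsum_add (hsum y)
      map_smul' := fun c x => by
        simp only [map_smul, RingHom.id_apply]
        exact (hsum x).tsum_const_smul c }
  have hT : ∀ ψ, ‖T ψ‖ ≤ C * ‖A‖ * ‖ψ‖ := by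
    intro ψ
    refine le_of_tendsto (hsum ψ).hasSum.norm (Filter.Eventually.of_forall fun F => ?_)
    refine (key F ψ).trans ?_
    gcongr
    rw [Real.sqrt_le_left (norm_nonneg _)]
    exact hR F ψ
  exact ⟨T.mkContinuous _ hT, T.mkContinuous_norm_le (by positivity) hT,
    fun ψ => (hsum ψ).hasSum⟩

namespace IsResolution

variable [CompleteSpace E] {ι : Type*} {P : ι → (E →L[ℂ] E)}

theorem inner_left (hP : IsResolution P) (i : ι) (ψ φ : E) :
    inner ℂ (P i ψ) φ = (inner ℂ ψ (P i φ) : ℂ) := by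
  conv_lhs => rw [← (hP.isSelfAdjoint i).star_eq]
  rw [ContinuousLinearMap.star_eq_adjoint, ContinuousLinearMap.adjoint_inner_left]

theorem apply_self (hP : IsResolution P) (i : ι) (ψ : E) : P i (P i ψ) = P i ψ := by
  rw [← mul_apply_eq_comp, hP.mul_self]

theorem apply_of_ne (hP : IsResolution P) {i j : ι} (h : i ≠ j) (ψ : E) : P i (P j ψ) = 0 := by
  rw [← mul_apply_eq_comp, hP.mul_of_ne i j h]; simp

theorem hasSum_norm_sq (hP : IsResolution P) (ψ : E) :
    HasSum (fun i => ‖P i ψ‖ ^ 2) (‖ψ‖ ^ 2) := by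
  have h := (hP.hasSum ψ).mapL ((Complex.reCLM.comp
    ((innerSL ℂ ψ).restrictScalars ℝ)))
  simp only [ContinuousLinearMap.comp_apply, ContinuousLinearMap.coe_restrictScalars',
    innerSL_apply_apply, Complex.reCLM_apply] at h
  convert h using 2 with i
  · conv_rhs => rw [← hP.apply_self, ← hP.inner_left, inner_self_eq_norm_sq_to_K]
    norm_cast
  · rw [inner_self_eq_norm_sq_to_K]
    norm_cast

theorem sum_norm_sq_le (hP : IsResolution P) (F : Finset ι) (ψ : E) :
    ∑ i ∈ F, ‖P i ψ‖ ^ 2 ≤ ‖ψ‖ ^ 2 :=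
  sum_le_hasSum F (fun i _ => by positivity) (hP.hasSum_norm_sq ψ)

theorem ext_apply (hP : IsResolution P) {ψ φ : E} (h : ∀ i, P i ψ = P i φ) : ψ = φ :=
  (hP.hasSum ψ).unique (by simpa only [h] using hP.hasSum φ)

/-- An operator is determined by its blocks. -/
theorem ext (hP : IsResolution P) {S T : E →L[ℂ] E}
    (h : ∀ i j, P i * S * P j = P i * T * P j) : S = T := by
  ext ψ
  refine hP.ext_apply fun i => ?_
  have hS := (hP.hasSum ψ).mapL (P i * S)
  have hT := (hP.hasSum ψ).mapL (P i * T)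
  have hST : (fun j => (P i * S) (P j ψ)) = fun j => (P i * T) (P j ψ) :=
    funext fun j => DFunLike.congr_fun (h i j) ψ
  rw [hST] at hS
  exact hS.unique hT

/-- The diagonal operator `∑ᵢ f(i) Pᵢ` of a bounded function `f`. -/
theorem exists_diagonal (hP : IsResolution P) (f : ι → ℂ) {C : ℝ} (hC : 0 ≤ C)
    (hf : ∀ i, ‖f i‖ ≤ C) :
    ∃ D : E →L[ℂ] E, (∀ i, P i * D = f i • P i) ∧ (∀ i, D * P i = f i • P i) := by
  obtain ⟨D, -, hD⟩ := exists_hasSum_mul_mul (fun i => f i • P i) P hC (fun F φ => by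
    calc _ ≤ ∑ i ∈ F, C ^ 2 * ‖P i φ‖ ^ 2 := by
          refine Finset.sum_le_sum fun i _ => ?_
          rw [star_smul, (hP.isSelfAdjoint i).star_eq, smul_apply, norm_smul,
            mul_pow, norm_star]
          gcongr
          exact hf i
      _ ≤ _ := by
          rw [← Finset.mul_sum]
          gcongr
          exact hP.sum_norm_sq_le F φ) hP.sum_norm_sq_le 1
  have hD' : ∀ ψ, HasSum (fun i => f i • P i ψ) (D ψ) := fun ψ => by
    simpa [hP.apply_self] using hD ψ
  have h1 : ∀ i ψ, P i (D ψ) = f i • P i ψ := fun i ψ => by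
    refine ((hD' ψ).mapL (P i)).unique ?_
    convert hasSum_single i fun j hj => ?_ using 1
    · simp [hP.apply_self]
    · simp [hP.apply_of_ne hj.symm]
  refine ⟨D, fun i => ContinuousLinearMap.ext (h1 i), fun i => ContinuousLinearMap.ext fun ψ => ?_⟩
  refine hP.ext_apply fun j => ?_
  rw [mul_apply_eq_comp, h1, smul_apply, map_smul]
  by_cases h : j = i
  · rw [h]
  · simp [hP.apply_of_ne h]

/-- Schur multiplication of the blocks `Pₖ A Pₗ` by a matrix whose rows are bounded by `C` in `ℓ²`
is a linear map of norm at most `C`. -/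
theorem exists_schur (hP : IsResolution P) (M : ι → ι → ℂ) {C : ℝ} (hC : 0 ≤ C)
    (hM : ∀ k (F : Finset ι), ∑ l ∈ F, ‖M k l‖ ^ 2 ≤ C ^ 2) :
    ∃ Γ : (E →L[ℂ] E) →ₗ[ℂ] (E →L[ℂ] E), (∀ A, ‖Γ A‖ ≤ C * ‖A‖) ∧
      ∀ A k l, P k * Γ A * P l = M k l • (P k * A * P l) := by
  have hM1 : ∀ k l, ‖M k l‖ ≤ C := fun k l => by
    have := hM k {l}
    rw [Finset.sum_singleton] at this
    exact (pow_le_pow_iff_left₀ (norm_nonneg _) hC two_ne_zero).1 this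
  choose L hL1 hL2 using fun l => hP.exists_diagonal (fun k => M k l) hC (fun k => hM1 k l)
  have hstar : ∀ k l φ, P k (star (L l) φ) = star (M k l) • P k φ := fun k l φ => by
    have := congrArg star (hL2 l k)
    rw [star_mul, star_smul, (hP.isSelfAdjoint k).star_eq] at this
    exact DFunLike.congr_fun this φ
  have hL : ∀ (F : Finset ι) φ, ∑ l ∈ F, ‖star (L l) φ‖ ^ 2 ≤ C ^ 2 * ‖φ‖ ^ 2 := by
    intro F φ
    have h1 := hasSum_sum (s := F) fun l _ => hP.hasSum_norm_sq (star (L l) φ)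
    refine hasSum_le (fun k => ?_) h1 ((hP.hasSum_norm_sq φ).mul_left (C ^ 2))
    simp only [hstar, norm_smul, norm_star, mul_pow]
    rw [← Finset.sum_mul]
    gcongr
    exact hM k F
  choose T hT hTsum using exists_hasSum_mul_mul L P hC hL hP.sum_norm_sq_le
  have hblock : ∀ A k l, P k * T A * P l = M k l • (P k * A * P l) := by
    intro A k l
    ext ψ
    have h := (hTsum A (P l ψ)).mapL (P k)
    simp only [mul_apply_eq_comp, smul_apply]
    refine h.unique ?_
    convert hasSum_single l fun j hj => ?_ using 1
    · have := DFunLike.congr_fun (hL1 l k) (A (P l ψ))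
      simp only [mul_apply_eq_comp, smul_apply] at this
      rw [hP.apply_self, this]
    · simp [hP.apply_of_ne hj]
  refine ⟨{ toFun := T, map_add' := fun A B => hP.ext fun k l => ?_,
            map_smul' := fun c A => hP.ext fun k l => ?_ }, hT, hblock⟩
  · rw [mul_add, add_mul, hblock, hblock, hblock, mul_add, add_mul, smul_add]
  · rw [RingHom.id_apply, mul_smul_comm, smul_mul_assoc, hblock, hblock, mul_smul_comm,
      smul_mul_assoc, smul_comm]

end IsResolution

end

/-! ### Sums over a separated set of reals -/

section

/-- The integer parts `⌊x / δ⌋` of `δ`-separated reals `x ≥ δ` are distinct positive integers, so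
that the sum of `x⁻²` is at most `δ⁻² ζ(2)`. -/
theorem sum_inv_sq_le_of_separated_of_le {δ : ℝ} (hδ : 0 < δ) (F : Finset ℝ) (hF : ∀ x ∈ F, δ ≤ x)
    (hsep : ∀ x ∈ F, ∀ y ∈ F, x ≠ y → δ ≤ |x - y|) :
    ∑ x ∈ F, (x⁻¹) ^ 2 ≤ (δ⁻¹) ^ 2 * (Real.pi ^ 2 / 6) := by
  have hfl : ∀ x ∈ F, 1 ≤ ⌊x / δ⌋₊ := fun x hx => by
    rw [Nat.le_floor_iff' one_ne_zero, Nat.cast_one, le_div_iff₀ hδ, one_mul]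
    exact hF x hx
  have hinj : Set.InjOn (fun x : ℝ => ⌊x / δ⌋₊) F := by
    intro x hx y hy hxy
    by_contra hne
    have h := hsep x hx y hy hne
    have hx0 : 0 ≤ x / δ := div_nonneg (hδ.le.trans (hF x hx)) hδ.le
    have hy0 : 0 ≤ y / δ := div_nonneg (hδ.le.trans (hF y hy)) hδ.le
    have h1 := Nat.floor_le hx0
    have h2 := Nat.lt_floor_add_one (x / δ)
    have h3 := Nat.floor_le hy0
    have h4 := Nat.lt_floor_add_one (y / δ)
    simp only at hxy
    rw [hxy] at h1 h2
    have h5 : |x / δ - y / δ| < 1 := by rw [abs_lt]; constructor <;> linarith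
    rw [← sub_div, abs_div, abs_of_pos hδ, div_lt_one hδ] at h5
    linarith
  calc ∑ x ∈ F, (x⁻¹) ^ 2 ≤ ∑ x ∈ F, (δ⁻¹) ^ 2 * (1 / (⌊x / δ⌋₊ : ℝ) ^ 2) := by
        refine Finset.sum_le_sum fun x hx => ?_
        have h0 : (1 : ℝ) ≤ (⌊x / δ⌋₊ : ℝ) := by exact_mod_cast hfl x hx
        have hx0 : 0 < x := hδ.trans_le (hF x hx)
        have h1 := Nat.floor_le (div_nonneg hx0.le hδ.le)
        rw [le_div_iff₀ hδ] at h1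
        rw [one_div, ← inv_pow, ← mul_pow, ← mul_inv, mul_comm δ]
        gcongr
    _ = (δ⁻¹) ^ 2 * ∑ n ∈ F.image (fun x : ℝ => ⌊x / δ⌋₊), 1 / (n : ℝ) ^ 2 := by
        rw [Finset.sum_image hinj, Finset.mul_sum]
    _ ≤ _ := by
        gcongr
        exact sum_le_hasSum _ (fun n _ => by positivity) hasSum_zeta_two

theorem sum_inv_sq_le_of_separated {δ : ℝ} (hδ : 0 < δ) (F : Finset ℝ) (hF : ∀ x ∈ F, δ ≤ |x|)
    (hsep : ∀ x ∈ F, ∀ y ∈ F, x ≠ y → δ ≤ |x - y|) :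
    ∑ x ∈ F, (x⁻¹) ^ 2 ≤ (Real.pi / (√3 * δ)) ^ 2 := by
  have h1 := sum_inv_sq_le_of_separated_of_le hδ (F.filter (0 ≤ ·))
    (fun x hx => by
      have := Finset.mem_filter.1 hx
      rw [← abs_of_nonneg this.2]; exact hF x this.1)
    (fun x hx y hy => hsep x (Finset.mem_filter.1 hx).1 y (Finset.mem_filter.1 hy).1)
  have h2 := sum_inv_sq_le_of_separated_of_le hδ ((F.filter (¬ 0 ≤ ·)).image (- ·))
    (fun x hx => by
      obtain ⟨y, hy, rfl⟩ := Finset.mem_image.1 hx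
      have := Finset.mem_filter.1 hy
      rw [← abs_of_neg (not_le.1 this.2)]; exact hF y this.1)
    (fun x hx y hy hne => by
      obtain ⟨x', hx', rfl⟩ := Finset.mem_image.1 hx
      obtain ⟨y', hy', rfl⟩ := Finset.mem_image.1 hy
      have := hsep x' (Finset.mem_filter.1 hx').1 y' (Finset.mem_filter.1 hy').1
        (fun h => hne (by rw [h]))
      rwa [← neg_sub', abs_neg])
  rw [Finset.sum_image neg_injective.injOn] at h2
  simp only [inv_neg, neg_sq] at h2
  rw [← Finset.sum_filter_add_sum_filter_not F (0 ≤ ·)]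
  have h3 : (Real.pi / (√3 * δ)) ^ 2 =
      (δ⁻¹) ^ 2 * (Real.pi ^ 2 / 6) + (δ⁻¹) ^ 2 * (Real.pi ^ 2 / 6) := by
    rw [div_pow, mul_pow, Real.sq_sqrt (by norm_num)]
    field_simp
    norm_num
  rw [h3]
  exact add_le_add h1 h2

variable {E : Type*} [NormedAddCommGroup E] [InnerProductSpace ℂ E] [CompleteSpace E]

/-! ### The spectral decomposition of the unperturbed operator -/

/-- `H = ∑ᵢ h(i) Pᵢ` on its maximal domain: the `Pᵢ` are an orthogonal resolution of the identity,
and `H ψ = φ` if and only if `Pᵢ φ = h(i) Pᵢ ψ` for all `i`. -/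
structure IsDiagonalization {ι : Type*} (H : E →ₗ.[ℂ] E) (h : ι → ℝ) (P : ι → (E →L[ℂ] E)) :
    Prop extends IsResolution P where
  mem_graph_iff : ∀ ψ φ, (ψ, φ) ∈ H.graph ↔ ∀ i, P i φ = (h i : ℂ) • P i ψ

theorem isClosed_eigenspace {H : E →ₗ.[ℂ] E} (hH : IsSelfAdjoint H) (h : ℝ) :
    IsClosed (eigenspace H h : Set E) := by
  have : (eigenspace H h : Set E) = (fun ψ => (ψ, (h : ℂ) • ψ)) ⁻¹' (H.graph : Set (E × E)) := rfl
  rw [this]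
  exact hH.isClosed.preimage (by fun_prop)

theorem inner_eq_of_mem_graph {H : E →ₗ.[ℂ] E} (hH : IsSelfAdjoint H) {ψ φ ψ' φ' : E}
    (h : (ψ, φ) ∈ H.graph) (h' : (ψ', φ') ∈ H.graph) : inner ℂ φ ψ' = (inner ℂ ψ φ' : ℂ) := by
  have hs := LinearPMap.adjoint_isFormalAdjoint hH.dense_domain
  rw [LinearPMap.isSelfAdjoint_def.1 hH] at hs
  rw [LinearPMap.mem_graph_iff] at h h'
  obtain ⟨x, rfl, rfl⟩ := h
  obtain ⟨y, rfl, rfl⟩ := h'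
  exact hs x y

theorem mem_graph_of_inner_eq {H : E →ₗ.[ℂ] E} (hH : IsSelfAdjoint H) {ψ φ : E}
    (h : ∀ x y, (x, y) ∈ H.graph → inner ℂ x φ = (inner ℂ y ψ : ℂ)) : (ψ, φ) ∈ H.graph := by
  have h1 : ∀ x : H.domain, inner ℂ φ (x : E) = (inner ℂ ψ (H x) : ℂ) := fun x => by
    rw [← inner_conj_symm, h x (H x) (H.mem_graph x), inner_conj_symm]
  have h2 := LinearPMap.mem_adjoint_domain_of_exists ψ ⟨φ, h1⟩
  have h3 := LinearPMap.adjoint_apply_eq hH.dense_domain ⟨ψ, h2⟩ h1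
  have h4 := H.adjoint.mem_graph ⟨ψ, h2⟩
  have h5 : (ψ, φ) ∈ H.adjoint.graph := h3 ▸ h4
  rwa [LinearPMap.isSelfAdjoint_def.1 hH] at h5

/-- A self-adjoint operator with pure point spectrum is diagonalized by the projections onto its
eigenspaces. -/
theorem exists_isDiagonalization {H : E →ₗ.[ℂ] E} (hH : IsSelfAdjoint H)
    (hpp : HasPurePointSpectrum H) :
    ∃ P : eigenvalues H → (E →L[ℂ] E), IsDiagonalization H (fun i : eigenvalues H => (i : ℝ)) P ∧
      ∀ (i : eigenvalues H) ψ, ψ ∈ eigenspace H i ↔ P i ψ = ψ := by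
  have : ∀ h : ℝ, (eigenspace H h).HasOrthogonalProjection := fun h => by
    have := (isClosed_eigenspace hH h).completeSpace_coe
    infer_instance
  set P : eigenvalues H → (E →L[ℂ] E) := fun i => (eigenspace H i).starProjection
  have hfix : ∀ (i : eigenvalues H) ψ, ψ ∈ eigenspace H i ↔ P i ψ = ψ := fun i ψ =>
    Submodule.starProjection_eq_self_iff.symm
  have hmem : ∀ (i : eigenvalues H) ψ, P i ψ ∈ eigenspace H i := fun i ψ =>
    Submodule.starProjection_apply_mem _ _
  have hsa : ∀ i, IsSelfAdjoint (P i) := fun i => isStarProjection_starProjection.isSelfAdjoint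
  have hinner : ∀ i ψ φ, inner ℂ (P i ψ) φ = (inner ℂ ψ (P i φ) : ℂ) := fun i ψ φ => by
    conv_lhs => rw [← (hsa i).star_eq]
    rw [ContinuousLinearMap.star_eq_adjoint, ContinuousLinearMap.adjoint_inner_left]
  have hidem : ∀ i, P i * P i = P i := fun i => ContinuousLinearMap.ext fun ψ =>
    (hfix i _).1 (hmem i ψ)
  have horth : ∀ i j : eigenvalues H, i ≠ j → ∀ ψ φ, inner ℂ (P i ψ) (P j φ) = (0 : ℂ) := by
    intro i j hij ψ φ
    have h := inner_eq_of_mem_graph hH (hmem i ψ) (hmem j φ)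
    rw [inner_smul_left, inner_smul_right, Complex.conj_ofReal] at h
    have h' : ((i : ℝ) : ℂ) - ((j : ℝ) : ℂ) ≠ 0 := by
      rw [sub_ne_zero]
      exact fun e => hij (Subtype.ext (Complex.ofReal_injective e))
    have : (((i : ℝ) : ℂ) - ((j : ℝ) : ℂ)) * inner ℂ (P i ψ) (P j φ) = 0 := by
      rw [sub_mul, h, sub_self]
    exact (mul_eq_zero.1 this).resolve_left h'
  have hmul : ∀ i j, i ≠ j → P i * P j = 0 := fun i j hij => ContinuousLinearMap.ext fun ψ => by
    rw [mul_apply_eq_comp, zero_apply, ← inner_self_eq_zero (𝕜 := ℂ), hinner]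
    rw [← mul_apply_eq_comp, hidem, ← hinner]
    exact horth i j hij _ _
  have hbessel : ∀ (F : Finset (eigenvalues H)) ψ, ∑ i ∈ F, ‖P i ψ‖ ^ 2 ≤ ‖ψ‖ ^ 2 := by
    intro F ψ
    set χ := ∑ i ∈ F, P i ψ with hχ
    have hc : ((∑ i ∈ F, ‖P i ψ‖ ^ 2 : ℝ) : ℂ) = inner ℂ χ ψ := by
      rw [hχ, sum_inner, Complex.ofReal_sum]
      refine Finset.sum_congr rfl fun i _ => ?_
      conv_rhs => rw [← hidem i, mul_apply_eq_comp, hinner, inner_self_eq_norm_sq_to_K]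
      norm_cast
    have hc' : ((∑ i ∈ F, ‖P i ψ‖ ^ 2 : ℝ) : ℂ) = inner ℂ χ χ := by
      conv_rhs => rw [hχ, sum_inner]
      rw [Complex.ofReal_sum]
      refine Finset.sum_congr rfl fun i hi => ?_
      rw [inner_sum, Finset.sum_eq_single_of_mem i hi fun j _ hj => horth i j hj.symm ψ ψ,
        inner_self_eq_norm_sq_to_K]
      norm_cast
    have h1 : ∑ i ∈ F, ‖P i ψ‖ ^ 2 = ‖χ‖ ^ 2 := by
      refine Complex.ofReal_injective ?_
      rw [hc', inner_self_eq_norm_sq_to_K]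
      simp
    have h2 : ‖χ‖ ^ 2 ≤ ‖χ‖ * ‖ψ‖ := by
      have h3 := norm_inner_le_norm (𝕜 := ℂ) χ ψ
      rwa [← hc, h1, Complex.norm_real, Real.norm_of_nonneg (by positivity)] at h3
    rw [h1]
    nlinarith [norm_nonneg χ, norm_nonneg ψ, sq_nonneg (‖χ‖ - ‖ψ‖)]
  have htot : ∀ ψ, (∀ i, P i ψ = 0) → ψ = 0 := by
    intro ψ h
    have h1 : ψ ∈ (⨆ h : ℝ, eigenspace H h)ᗮ := by
      rw [← Submodule.iInf_orthogonal, Submodule.mem_iInf]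
      intro k
      rw [Submodule.mem_orthogonal]
      intro x hx
      by_cases hk : k ∈ eigenvalues H
      · rw [← (hfix ⟨k, hk⟩ x).1 hx, hinner, h, inner_zero_right]
      · rw [eigenvalues, Set.mem_ofPred_eq, not_not] at hk
        rw [hk, Submodule.mem_bot] at hx
        rw [hx, inner_zero_left]
    rw [Submodule.topologicalClosure_eq_top_iff.1 hpp] at h1
    exact h1
  obtain ⟨T, -, hT⟩ := exists_hasSum_mul_mul P P zero_le_one (fun F φ => by
    simpa [(hsa _).star_eq] using hbessel F φ) hbessel 1
  have hT' : ∀ ψ, HasSum (fun i => P i ψ) (T ψ) := fun ψ => by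
    convert hT ψ using 2 with i
    exact (DFunLike.congr_fun (hidem i) ψ).symm
  have hsum : ∀ ψ, HasSum (fun i => P i ψ) ψ := fun ψ => by
    have : T ψ - ψ = 0 := htot _ fun i => by
      rw [map_sub, sub_eq_zero]
      refine ((hT' ψ).mapL (P i)).unique ?_
      convert hasSum_single i fun j hj => ?_ using 1
      · exact (DFunLike.congr_fun (hidem i) ψ).symm
      · exact DFunLike.congr_fun (hmul i j hj.symm) ψ
    rw [sub_eq_zero] at this
    simpa only [this] using hT' ψ
  refine ⟨P, ⟨⟨hsa, hidem, hmul, hsum⟩, fun ψ φ => ⟨fun h i => ?_, fun h => ?_⟩⟩, hfix⟩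
  · refine ext_inner_left ℂ fun χ => ?_
    rw [← hinner, inner_smul_right, ← hinner, ← inner_eq_of_mem_graph hH (hmem i χ) h,
      inner_smul_left, Complex.conj_ofReal]
  · refine mem_graph_of_inner_eq hH fun x y hxy => ?_
    have h1 := (hsum φ).mapL (innerSL ℂ x)
    have h2 := (hsum ψ).mapL (innerSL ℂ y)
    simp only [innerSL_apply_apply] at h1 h2
    refine h1.unique ?_
    convert h2 using 2 with i
    rw [h i, inner_eq_of_mem_graph hH hxy (hmem i ψ)]

end

/-! ### Commutators with the unperturbed operator -/

section

variable {E : Type*} [NormedAddCommGroup E] [InnerProductSpace ℂ E]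

/-- `[H, T] = R`: the bounded operator `T` maps the domain of `H` into itself and
`H T = T H + R` there. -/
def HasCommutator (H : E →ₗ.[ℂ] E) (T R : E →L[ℂ] E) : Prop :=
  ∀ ψ φ, (ψ, φ) ∈ H.graph → (T ψ, T φ + R ψ) ∈ H.graph

theorem HasCommutator.mul {H : E →ₗ.[ℂ] E} {T R T' R' : E →L[ℂ] E} (h : HasCommutator H T R)
    (h' : HasCommutator H T' R') : HasCommutator H (T * T') (R * T' + T * R') := by
  intro ψ φ hg
  have e : (T * T') φ + (R * T' + T * R') ψ = T (T' φ + R' ψ) + R (T' ψ) := by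
    simp only [mul_apply_eq_comp, add_apply, map_add]
    abel
  rw [e]
  exact h _ _ (h' ψ φ hg)

variable [CompleteSpace E]

namespace IsResolution

variable {ι : Type*} {P : ι → (E →L[ℂ] E)}

theorem commute_of_offDiagonal_eq_zero (hP : IsResolution P) {T : E →L[ℂ] E}
    (h : ∀ i j, i ≠ j → P i * T * P j = 0) (i : ι) : Commute T (P i) := by
  refine hP.ext fun k l => ?_
  have e1 : P k * (T * P i) * P l = P k * T * (P i * P l) := by simp only [mul_assoc]
  have e2 : P k * (P i * T) * P l = P k * P i * (T * P l) := by simp only [mul_assoc]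
  rw [e1, e2]
  by_cases hl : i = l
  · subst hl
    rw [hP.mul_self]
    by_cases hk : k = i
    · rw [hk, hP.mul_self, mul_assoc]
    · rw [h k i hk, hP.mul_of_ne k i hk, zero_mul]
  · rw [hP.mul_of_ne i l hl, mul_zero]
    by_cases hk : k = i
    · rw [hk, hP.mul_self, ← mul_assoc, h i l hl]
    · rw [hP.mul_of_ne k i hk, zero_mul]

theorem offDiagonal_eq_zero (hP : IsResolution P) {T : E →L[ℂ] E} (hT : ∀ i, Commute T (P i))
    {i j : ι} (hij : i ≠ j) : P i * T * P j = 0 := by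
  rw [mul_assoc, (hT j).eq, ← mul_assoc, hP.mul_of_ne i j hij, zero_mul]

/-- The block-diagonal part `∑ᵢ Pᵢ A Pᵢ` of an operator. -/
theorem exists_diagonalPart (hP : IsResolution P) :
    ∃ Δ : (E →L[ℂ] E) →ₗ[ℂ] (E →L[ℂ] E), (∀ A, ‖Δ A‖ ≤ ‖A‖) ∧
      (∀ A i, P i * Δ A * P i = P i * A * P i) ∧ ∀ A i, Commute (Δ A) (P i) := by
  classical
  obtain ⟨Δ, h1, h2⟩ := hP.exists_schur (fun k l => if k = l then 1 else 0) zero_le_one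
    (fun k F => by
      calc _ = ∑ l ∈ F, (if k = l then (1 : ℝ) else 0) :=
            Finset.sum_congr rfl fun l _ => by split_ifs <;> simp
        _ ≤ _ := by
            rw [Finset.sum_ite_eq]
            split_ifs <;> simp)
  refine ⟨Δ, fun A => by simpa using h1 A, fun A i => by simpa using h2 A i i, fun A =>
    hP.commute_of_offDiagonal_eq_zero fun i j hij => by simpa [hij] using h2 A i j⟩

end IsResolution

namespace IsDiagonalization

variable {ι : Type*} {H : E →ₗ.[ℂ] E} {h : ι → ℝ} {P : ι → (E →L[ℂ] E)}

theorem proj_mem_graph (D : IsDiagonalization H h P) (i : ι) (ψ : E) :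
    (P i ψ, (h i : ℂ) • P i ψ) ∈ H.graph := by
  rw [D.mem_graph_iff]
  intro j
  rw [map_smul]
  by_cases hj : j = i
  · rw [hj]
  · simp [D.apply_of_ne hj]

theorem hasCommutator_iff (D : IsDiagonalization H h P) {T R : E →L[ℂ] E} :
    HasCommutator H T R ↔
      ∀ i j, P i * R * P j = ((h i : ℂ) - (h j : ℂ)) • (P i * T * P j) := by
  constructor
  · intro hTR i j
    ext ψ
    have h1 := (D.mem_graph_iff _ _).1 (hTR _ _ (D.proj_mem_graph j ψ)) i
    rw [map_add, map_smul, map_smul] at h1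
    simp only [mul_apply_eq_comp, smul_apply]
    rw [sub_smul, ← h1]
    abel
  · intro hTR ψ φ hg
    rw [D.mem_graph_iff] at hg ⊢
    intro i
    have h1 := ((D.hasSum φ).mapL (P i * T)).add ((D.hasSum ψ).mapL (P i * R))
    have h2 := ((D.hasSum ψ).mapL (P i * T)).const_smul (h i : ℂ)
    have h3 : (fun j => (P i * T) (P j φ) + (P i * R) (P j ψ)) =
        fun j => (h i : ℂ) • (P i * T) (P j ψ) := by
      funext j
      have h4 := DFunLike.congr_fun (hTR i j) ψ
      simp only [mul_apply_eq_comp, smul_apply] at h4 ⊢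
      rw [hg j, h4, map_smul, map_smul, sub_smul]
      abel
    rw [h3] at h1
    rw [map_add]
    exact h1.unique h2

theorem hasCommutator_star (D : IsDiagonalization H h P) {T R : E →L[ℂ] E}
    (hT : HasCommutator H T R) : HasCommutator H (star T) (-star R) := by
  rw [D.hasCommutator_iff] at hT ⊢
  intro i j
  have h1 := congrArg star (hT j i)
  simp only [star_mul, star_smul, (D.isSelfAdjoint _).star_eq, star_sub, Complex.star_def,
    Complex.conj_ofReal] at h1
  rw [mul_neg, neg_mul, mul_assoc, h1, ← mul_assoc, ← neg_smul, neg_sub]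

theorem hasCommutator_zero (D : IsDiagonalization H h P) {T : E →L[ℂ] E}
    (hT : ∀ i, Commute T (P i)) : HasCommutator H T 0 := by
  intro ψ φ hg
  rw [D.mem_graph_iff] at hg ⊢
  intro i
  rw [zero_apply, add_zero, ← mul_apply_eq_comp, ← mul_apply_eq_comp, ← (hT i).eq,
    mul_apply_eq_comp, mul_apply_eq_comp, hg i, map_smul]

theorem hasCommutator_unique (D : IsDiagonalization H h P) {T R R' : E →L[ℂ] E}
    (hR : HasCommutator H T R) (hR' : HasCommutator H T R') : R = R' := by
  rw [D.hasCommutator_iff] at hR hR'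
  exact D.ext fun i j => by rw [hR, hR']

/-- The equation `[H, T] = A` is solved, up to the block-diagonal part of `A`, by Schur
multiplication with `(h(i) - h(j))⁻¹`. Its rows are square summable because the eigenvalues are
separated. The diagonal entries are `0⁻¹ = 0`. -/
theorem exists_inverseCommutator (D : IsDiagonalization H h P) {δ : ℝ} (hδ : 0 < δ)
    (hsep : ∀ i j, i ≠ j → δ ≤ |h i - h j|) :
    ∃ Γ : (E →L[ℂ] E) →ₗ[ℂ] (E →L[ℂ] E), (∀ A, ‖Γ A‖ ≤ Real.pi / (√3 * δ) * ‖A‖) ∧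
      ∀ A i j, P i * Γ A * P j = ((h i : ℂ) - (h j : ℂ))⁻¹ • (P i * A * P j) := by
  classical
  refine D.exists_schur (fun i j => ((h i : ℂ) - (h j : ℂ))⁻¹) (by positivity) fun k F => ?_
  have hinj : Function.Injective fun j => h k - h j := by
    intro i j hij
    by_contra hne
    have := hsep i j hne
    rw [show h i - h j = 0 by simp only at hij; linarith, abs_zero] at this
    linarith
  calc ∑ l ∈ F, ‖((h k : ℂ) - (h l : ℂ))⁻¹‖ ^ 2 = ∑ l ∈ F, ((h k - h l)⁻¹) ^ 2 := by
        refine Finset.sum_congr rfl fun l _ => ?_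
        rw [← Complex.ofReal_sub, norm_inv, Complex.norm_real, Real.norm_eq_abs, ← abs_inv, sq_abs]
    _ = ∑ l ∈ F.erase k, ((h k - h l)⁻¹) ^ 2 := by
        rw [Finset.sum_erase]
        simp
    _ = ∑ x ∈ (F.erase k).image (fun j => h k - h j), (x⁻¹) ^ 2 := by
        rw [Finset.sum_image hinj.injOn]
    _ ≤ _ := by
        refine sum_inv_sq_le_of_separated hδ _ (fun x hx => ?_) fun x hx y hy hne => ?_
        · obtain ⟨j, hj, rfl⟩ := Finset.mem_image.1 hx
          exact hsep k j (Finset.ne_of_mem_erase hj).symm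
        · obtain ⟨i, hi, rfl⟩ := Finset.mem_image.1 hx
          obtain ⟨j, hj, rfl⟩ := Finset.mem_image.1 hy
          have hij : j ≠ i := fun e => hne (by rw [e])
          rw [sub_sub_sub_cancel_left]
          exact hsep j i hij

end IsDiagonalization

/-! ### Banach and C⋆-algebra lemmas -/

/-- The Bloch equation `Y = Γ(Y Δ(V + VY) - (V + VY))` has a small solution: the right-hand side is
a contraction of the ball of radius `3κ/2`, where `κ = g ‖V‖`. -/
theorem exists_bloch_solution {A : Type*} [NormedRing A] [NormedAlgebra ℂ A] [CompleteSpace A]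
    (Γ Δ : A →ₗ[ℂ] A) {g : ℝ} (hg : 0 ≤ g) (hΓ : ∀ a, ‖Γ a‖ ≤ g * ‖a‖) (hΔ : ∀ a, ‖Δ a‖ ≤ ‖a‖)
    (V : A) (hV : g * ‖V‖ ≤ 1 / 8) :
    ∃ Y, ‖Y‖ ≤ 3 / 2 * (g * ‖V‖) ∧ Γ (Y * Δ (V + V * Y) - (V + V * Y)) = Y := by
  set κ := g * ‖V‖ with hκ
  have hκ0 : 0 ≤ κ := by positivity
  set r := 3 / 2 * κ with hr
  have hr0 : 0 ≤ r := by positivity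
  set F : A → A := fun Y => Γ (Y * Δ (V + V * Y) - (V + V * Y)) with hF
  have hVY : ∀ Y, ‖Y‖ ≤ r → ‖V + V * Y‖ ≤ ‖V‖ * (1 + r) := fun Y hY => by
    calc _ ≤ ‖V‖ + ‖V‖ * ‖Y‖ := (norm_add_le _ _).trans (by gcongr; exact norm_mul_le _ _)
      _ ≤ ‖V‖ + ‖V‖ * r := by gcongr
      _ = _ := by ring
  have hmaps : Set.MapsTo F (Metric.closedBall 0 r) (Metric.closedBall 0 r) := by
    intro Y hY
    rw [mem_closedBall_zero_iff] at hY ⊢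
    calc _ ≤ g * ‖Y * Δ (V + V * Y) - (V + V * Y)‖ := hΓ _
      _ ≤ g * (r * (‖V‖ * (1 + r)) + ‖V‖ * (1 + r)) := by
          gcongr
          refine (norm_sub_le _ _).trans ?_
          gcongr
          · refine (norm_mul_le _ _).trans ?_
            gcongr
            exact (hΔ _).trans (hVY Y hY)
          · exact hVY Y hY
      _ = κ * (1 + r) ^ 2 := by rw [hκ]; ring
      _ ≤ κ * (3 / 2) := by
          gcongr
          nlinarith
      _ = r := by rw [hr]; ring
  have hlip : ∀ Y ∈ Metric.closedBall (0 : A) r, ∀ Y' ∈ Metric.closedBall (0 : A) r,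
      ‖F Y - F Y'‖ ≤ 1 / 2 * ‖Y - Y'‖ := by
    intro Y hY Y' hY'
    rw [mem_closedBall_zero_iff] at hY hY'
    have e : F Y - F Y' =
        Γ ((Y - Y') * Δ (V + V * Y) + Y' * Δ (V * (Y - Y')) - V * (Y - Y')) := by
      simp only [hF]
      rw [← map_sub]
      congr 1
      have : Δ (V * (Y - Y')) = Δ (V + V * Y) - Δ (V + V * Y') := by
        rw [← map_sub]
        congr 1
        noncomm_ring
      rw [this]
      noncomm_ring
    rw [e]
    calc _ ≤ g * ‖(Y - Y') * Δ (V + V * Y) + Y' * Δ (V * (Y - Y')) - V * (Y - Y')‖ := hΓ _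
      _ ≤ g * (‖Y - Y'‖ * (‖V‖ * (1 + r)) + r * (‖V‖ * ‖Y - Y'‖) + ‖V‖ * ‖Y - Y'‖) := by
          gcongr
          refine (norm_sub_le _ _).trans ?_
          gcongr
          · refine (norm_add_le _ _).trans ?_
            gcongr
            · refine (norm_mul_le _ _).trans ?_
              gcongr
              exact (hΔ _).trans (hVY Y hY)
            · refine (norm_mul_le _ _).trans ?_
              gcongr
              exact (hΔ _).trans (norm_mul_le _ _)
          · exact norm_mul_le _ _
      _ = κ * (2 + 2 * r) * ‖Y - Y'‖ := by rw [hκ]; ring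
      _ ≤ 1 / 2 * ‖Y - Y'‖ := by
          gcongr
          nlinarith
  have hcontr : ContractingWith (1 / 2) (hmaps.restrict F _ _) := by
    refine ⟨by rw [one_div]; exact NNReal.inv_lt_one_iff (by norm_num) |>.2 (by norm_num), ?_⟩
    refine LipschitzWith.of_dist_le_mul fun Y Y' => ?_
    rw [Subtype.dist_eq, Subtype.dist_eq, dist_eq_norm, dist_eq_norm]
    exact_mod_cast hlip Y Y.2 Y' Y'.2
  obtain ⟨Y, hY, hfix, -⟩ := hcontr.exists_fixedPoint' Metric.isClosed_closedBall.isComplete hmaps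
    (x := 0) (by simpa using hr0) (edist_ne_top _ _)
  exact ⟨Y, by simpa using hY, hfix⟩

/-- The square root of a self-adjoint element near `1`, together with its inverse. -/
theorem exists_sqrt_near_one {A : Type*} [CStarAlgebra A] {Z : A} (hZ : IsSelfAdjoint Z) {q : ℝ}
    (hq : ‖Z - 1‖ ≤ q) (hq4 : q ≤ 1 / 4) :
    ∃ S T : A, IsSelfAdjoint S ∧ IsSelfAdjoint T ∧ S * T = 1 ∧ T * S = 1 ∧ T * T = Z ∧
      ‖S - 1‖ ≤ q ∧ ∀ B, Commute Z B → Commute S B ∧ Commute T B := by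
  have hq0 : 0 ≤ q := (norm_nonneg _).trans hq
  have hspec : ∀ x ∈ spectrum ℝ Z, |x - 1| ≤ q := by
    intro x hx
    have h1 : cfc (fun x : ℝ => x - 1) Z = Z - 1 := by
      rw [cfc_sub (fun x : ℝ => x) (fun _ => (1 : ℝ)) Z, cfc_id' ℝ Z, cfc_const_one ℝ Z]
    have h2 := norm_apply_le_norm_cfc (fun x : ℝ => x - 1) Z hx
    rw [h1] at h2
    exact h2.trans hq
  have hpos : ∀ x ∈ spectrum ℝ Z, 0 < x := fun x hx => by
    have := abs_le.1 (hspec x hx)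
    linarith
  have hcT : ContinuousOn (fun x : ℝ => √x) (spectrum ℝ Z) := Real.continuous_sqrt.continuousOn
  have hcS : ContinuousOn (fun x : ℝ => (√x)⁻¹) (spectrum ℝ Z) :=
    hcT.inv₀ fun x hx => (Real.sqrt_pos.2 (hpos x hx)).ne'
  refine ⟨cfc (fun x : ℝ => (√x)⁻¹) Z, cfc (fun x : ℝ => √x) Z, cfc_predicate _ _,
    cfc_predicate _ _, ?_, ?_, ?_, ?_, fun B hB => ⟨(hB.cfc_real _), (hB.cfc_real _)⟩⟩
  · rw [← cfc_mul _ _ Z hcS hcT, ← cfc_one ℝ Z]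
    exact cfc_congr fun x hx => inv_mul_cancel₀ (Real.sqrt_pos.2 (hpos x hx)).ne'
  · rw [← cfc_mul _ _ Z hcT hcS, ← cfc_one ℝ Z]
    exact cfc_congr fun x hx => mul_inv_cancel₀ (Real.sqrt_pos.2 (hpos x hx)).ne'
  · rw [← cfc_mul _ _ Z hcT hcT]
    conv_rhs => rw [← cfc_id' ℝ Z]
    exact cfc_congr fun x hx => Real.mul_self_sqrt (hpos x hx).le
  · have h1 : cfc (fun x : ℝ => (√x)⁻¹ - 1) Z = cfc (fun x : ℝ => (√x)⁻¹) Z - 1 := by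
      rw [cfc_sub (fun x : ℝ => (√x)⁻¹) (fun _ => (1 : ℝ)) Z hcS, cfc_const_one ℝ Z]
    rw [← h1]
    refine norm_cfc_le hq0 fun x hx => ?_
    have hx1 := abs_le.1 (hspec x hx)
    have hs := Real.sqrt_pos.2 (hpos x hx)
    have hsq := Real.mul_self_sqrt (hpos x hx).le
    have h2 : (√x)⁻¹ - 1 = (1 - √x) / √x := by field_simp
    -- `|s⁻¹ - 1| = |1 - x| / (s (1 + s))` with `s = √x`, and `s (1 + s) ≥ 1` for `x ≥ 3/4`.
    have h3 : (1 - √x) / √x = (1 - x) / (√x * (1 + √x)) := by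
      rw [div_eq_div_iff hs.ne' (by positivity)]
      linear_combination (-√x) * hsq
    have h4 : 1 ≤ √x * (1 + √x) := by
      have : 1 / 4 ≤ √x := by
        rw [Real.le_sqrt (by norm_num) (hpos x hx).le]; linarith
      nlinarith
    rw [h2, h3, norm_div, Real.norm_eq_abs, Real.norm_of_nonneg (by positivity : 0 ≤ √x * (1 + √x)),
      abs_sub_comm]
    exact (div_le_self (abs_nonneg _) h4).trans (hspec x hx)

end

/-! ### Block-diagonalization of the perturbed operator -/

section

variable {E : Type*} [NormedAddCommGroup E] [InnerProductSpace ℂ E] [CompleteSpace E]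

theorem sub_ne_zero_of_separated {δ x y : ℝ} (hδ : 0 < δ) (h : δ ≤ |x - y|) :
    (x : ℂ) - (y : ℂ) ≠ 0 := by
  rw [← Complex.ofReal_sub, Complex.ofReal_ne_zero, ← abs_pos]
  exact hδ.trans_le h

namespace IsDiagonalization

variable {ι : Type*} {H : E →ₗ.[ℂ] E} {h : ι → ℝ} {P : ι → (E →L[ℂ] E)}

/-- The Bloch wave operator: `Ω = 1 + Y` near `1` with `Y` off-diagonal and
`(H + V) Ω = Ω (H + B)` for a block-diagonal `B`. -/
theorem exists_waveOperator (D : IsDiagonalization H h P) {δ : ℝ} (hδ : 0 < δ)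
    (hsep : ∀ i j, i ≠ j → δ ≤ |h i - h j|) (V : E →L[ℂ] E)
    (hV : Real.pi / (√3 * δ) * ‖V‖ ≤ 1 / 8) :
    ∃ Y B : E →L[ℂ] E, ‖Y‖ ≤ 3 / 2 * (Real.pi / (√3 * δ) * ‖V‖) ∧ ‖B‖ ≤ 3 / 2 * ‖V‖ ∧
      (∀ i, P i * Y * P i = 0) ∧ (∀ i, Commute B (P i)) ∧
      HasCommutator H (1 + Y) ((1 + Y) * B - V * (1 + Y)) := by
  obtain ⟨Γ, hΓ, hΓ'⟩ := D.exists_inverseCommutator hδ hsep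
  obtain ⟨Δ, hΔ, hΔ', hΔc⟩ := D.exists_diagonalPart
  have hinj : ∀ i j, i ≠ j → (h i : ℂ) - (h j : ℂ) ≠ 0 := fun i j hij =>
    sub_ne_zero_of_separated hδ (hsep i j hij)
  obtain ⟨Y, hY, hfix⟩ := exists_bloch_solution Γ Δ (by positivity) hΓ hΔ V hV
  set B := Δ (V + V * Y) with hB
  have hYblock := hΓ' (Y * B - (V + V * Y))
  rw [hfix] at hYblock
  have hY0 : ∀ i, P i * Y * P i = 0 := fun i => by simpa using hYblock i i
  refine ⟨Y, B, hY, ?_, hY0, hΔc _, D.hasCommutator_iff.2 fun i j => ?_⟩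
  · calc ‖B‖ ≤ ‖V‖ + ‖V‖ * ‖Y‖ :=
          (hΔ _).trans ((norm_add_le _ _).trans (by gcongr; exact norm_mul_le _ _))
      _ ≤ ‖V‖ + ‖V‖ * (1 / 2) := by
          gcongr
          linarith
      _ = _ := by ring
  · have e : P i * ((1 + Y) * B - V * (1 + Y)) * P j =
        P i * B * P j + P i * (Y * B - (V + V * Y)) * P j := by noncomm_ring
    have e' : P i * (1 + Y) * P j = P i * P j + P i * Y * P j := by noncomm_ring
    rw [e, e']
    by_cases hij : i = j
    · subst hij
      have h2 : P i * (Y * B) * P i = 0 := by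
        rw [mul_assoc, mul_assoc, (hΔc (V + V * Y) i).eq, ← mul_assoc, ← mul_assoc, hY0,
          zero_mul]
      rw [sub_self, zero_smul, mul_sub, sub_mul, h2, hΔ', zero_sub, add_neg_cancel]
    · rw [hYblock, D.offDiagonal_eq_zero (hΔc _) hij, D.mul_of_ne i j hij, zero_add, zero_add,
        smul_smul, mul_inv_cancel₀ (hinj i j hij), one_smul]

/-- If `[H, Z] = Z B - B† Z` with `B` block-diagonal and small, then the off-diagonal part of `Z`
solves a homogeneous linear equation whose only solution is zero. -/
theorem commute_of_hasCommutator (D : IsDiagonalization H h P) {δ : ℝ} (hδ : 0 < δ)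
    (hsep : ∀ i j, i ≠ j → δ ≤ |h i - h j|) {Z B : E →L[ℂ] E}
    (hB : Real.pi / (√3 * δ) * ‖B‖ ≤ 1 / 4) (hBc : ∀ i, Commute B (P i))
    (hZ : HasCommutator H Z (Z * B - star B * Z)) (i : ι) : Commute Z (P i) := by
  obtain ⟨Γ, hΓ, hΓ'⟩ := D.exists_inverseCommutator hδ hsep
  obtain ⟨Δ, hΔ, hΔ', hΔc⟩ := D.exists_diagonalPart
  have hinj : ∀ i j, i ≠ j → (h i : ℂ) - (h j : ℂ) ≠ 0 := fun i j hij =>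
    sub_ne_zero_of_separated hδ (hsep i j hij)
  have hBc' : ∀ i, Commute (star B) (P i) := fun i => by
    have := (hBc i).star_star
    rwa [(D.isSelfAdjoint i).star_eq] at this
  set X := Z - Δ Z with hX
  have hXΓ : Γ (X * B - star B * X) = X := by
    refine D.ext fun i j => ?_
    rw [hΓ']
    by_cases hij : i = j
    · subst hij
      rw [sub_self, inv_zero, zero_smul, hX, mul_sub, sub_mul, hΔ', sub_self]
    · have h1 : P i * (Δ Z * B - star B * Δ Z) * P j = 0 :=
        D.offDiagonal_eq_zero (fun k => ((hΔc Z k).mul_left (hBc k)).sub_left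
          ((hBc' k).mul_left (hΔc Z k))) hij
      have h2 : X * B - star B * X = (Z * B - star B * Z) - (Δ Z * B - star B * Δ Z) := by
        rw [hX]; noncomm_ring
      rw [h2, mul_sub (P i), sub_mul, h1, sub_zero, D.hasCommutator_iff.1 hZ, smul_smul,
        inv_mul_cancel₀ (hinj i j hij), one_smul, hX, mul_sub, sub_mul,
        D.offDiagonal_eq_zero (hΔc Z) hij, sub_zero]
  have hXn : ‖X‖ ≤ 1 / 2 * ‖X‖ := by
    calc ‖X‖ = ‖Γ (X * B - star B * X)‖ := by rw [hXΓ]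
      _ ≤ Real.pi / (√3 * δ) * (‖X‖ * ‖B‖ + ‖B‖ * ‖X‖) := by
          refine (hΓ _).trans ?_
          gcongr
          refine (norm_sub_le _ _).trans (add_le_add (norm_mul_le _ _) ?_)
          rw [← norm_star B]
          exact norm_mul_le _ _
      _ = 2 * (Real.pi / (√3 * δ) * ‖B‖) * ‖X‖ := by ring
      _ ≤ _ := by
          gcongr
          linarith
  have hX0 : X = 0 := norm_le_zero_iff.1 (by linarith)
  rw [sub_eq_zero.1 hX0]
  exact hΔc Z i

/-- The perturbed operator is unitarily equivalent, by a unitary near `1`, to a block-diagonal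
perturbation. -/
theorem exists_unitary_blockDiagonal (D : IsDiagonalization H h P) {δ : ℝ} (hδ : 0 < δ)
    (hsep : ∀ i j, i ≠ j → δ ≤ |h i - h j|) {V : E →L[ℂ] E} (hVsa : IsSelfAdjoint V)
    (hV : Real.pi / (√3 * δ) * ‖V‖ ≤ 1 / 8) :
    ∃ W B : E →L[ℂ] E, W ∈ unitary (E →L[ℂ] E) ∧ IsSelfAdjoint B ∧ (∀ i, Commute B (P i)) ∧
      HasCommutator H W (W * B - V * W) ∧ ‖W - 1‖ ≤ 2 * (Real.pi / (√3 * δ) * ‖V‖) := by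
  classical
  obtain ⟨Y, B, hY, hBn, hY0, hBc, hΩ⟩ := D.exists_waveOperator hδ hsep V hV
  set κ := Real.pi / (√3 * δ) * ‖V‖ with hκ
  have hκ0 : 0 ≤ κ := by positivity
  set Ω := 1 + Y with hΩdef
  set Z := star Ω * Ω with hZdef
  have hZ : HasCommutator H Z (Z * B - star B * Z) := by
    convert (D.hasCommutator_star hΩ).mul hΩ using 1
    rw [hZdef, star_sub, star_mul, star_mul, hVsa.star_eq]
    noncomm_ring
  have hBκ : Real.pi / (√3 * δ) * ‖B‖ ≤ 1 / 4 := by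
    calc _ ≤ Real.pi / (√3 * δ) * (3 / 2 * ‖V‖) := by gcongr
      _ = 3 / 2 * κ := by rw [hκ]; ring
      _ ≤ _ := by linarith
  have hZc := D.commute_of_hasCommutator hδ hsep hBκ hBc hZ
  have hZB : Z * B = star B * Z :=
    sub_eq_zero.1 (D.hasCommutator_unique hZ (D.hasCommutator_zero hZc))
  obtain ⟨Δ, hΔ, hΔ', hΔc⟩ := D.exists_diagonalPart
  have hYstar : ∀ i, P i * star Y * P i = 0 := fun i => by
    have := congrArg star (hY0 i)
    rwa [star_mul, star_mul, (D.isSelfAdjoint i).star_eq, star_zero, ← mul_assoc] at this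
  have hZ1 : Z - 1 = Δ (star Y * Y) := by
    have e : Z - 1 = Y + star Y + star Y * Y := by
      rw [hZdef, hΩdef, star_add, star_one]
      noncomm_ring
    refine D.ext fun i j => ?_
    by_cases hij : i = j
    · subst hij
      rw [hΔ', e, mul_add, mul_add, add_mul, add_mul, hY0, hYstar, zero_add, zero_add]
    · rw [D.offDiagonal_eq_zero (hΔc _) hij,
        D.offDiagonal_eq_zero (fun k => (hZc k).sub_left (Commute.one_left _)) hij]
  have hZ1n : ‖Z - 1‖ ≤ ‖Y‖ ^ 2 := by
    rw [hZ1]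
    refine (hΔ _).trans ((norm_mul_le _ _).trans_eq ?_)
    rw [norm_star, sq]
  have hY4 : ‖Y‖ ≤ 3 / 16 := by linarith
  obtain ⟨S, T, hS, hT, hST, hTS, hTT, hS1, hcomm⟩ := exists_sqrt_near_one
    (IsSelfAdjoint.star_mul_self Ω) hZ1n (by nlinarith [norm_nonneg Y])
  have hΩunit : IsUnit Ω := by
    have := isUnit_one_sub_of_norm_lt_one (x := -Y) (by rw [norm_neg]; linarith)
    rwa [sub_neg_eq_add] at this
  have hSunit : IsUnit S := ⟨⟨S, T, hST, hTS⟩, rfl⟩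
  have hSc : ∀ i, Commute S (P i) := fun i => (hcomm _ (hZc i)).1
  have hTc : ∀ i, Commute T (P i) := fun i => (hcomm _ (hZc i)).2
  have hWW : star (Ω * S) * (Ω * S) = 1 := by
    rw [star_mul, hS.star_eq]
    calc S * star Ω * (Ω * S) = S * (star Ω * Ω) * S := by noncomm_ring
      _ = (S * T) * (T * S) := by rw [← hTT]; noncomm_ring
      _ = 1 := by rw [hST, hTS, one_mul]
  refine ⟨Ω * S, T * B * S, ?_, ?_, fun i => ((hTc i).mul_left (hBc i)).mul_left (hSc i), ?_, ?_⟩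
  · refine Unitary.mem_iff.2 ⟨hWW, (hΩunit.mul hSunit).mul_right_cancel ?_⟩
    rw [mul_assoc, hWW, mul_one, one_mul]
  · -- `Z B = B† Z` with `Z = T²`, multiplied by `S = T⁻¹` on both sides.
    have h1 : S * (T * T * B) * S = S * (star B * (T * T)) * S := by
      rw [hTT, hZB]
    have h2 : S * (T * T * B) * S = (S * T) * (T * B * S) := by noncomm_ring
    have h3 : S * (star B * (T * T)) * S = S * star B * T * (T * S) := by noncomm_ring
    rw [h2, h3, hST, hTS, one_mul, mul_one] at h1
    rw [isSelfAdjoint_iff, star_mul, star_mul, hS.star_eq, hT.star_eq, h1, mul_assoc]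
  · convert hΩ.mul (D.hasCommutator_zero hSc) using 1
    have h1 : Ω * S * (T * B * S) = Ω * (S * T) * B * S := by noncomm_ring
    rw [h1, hST]
    noncomm_ring
  · have e : Ω * S - 1 = Y * (S - 1) + Y + (S - 1) := by rw [hΩdef]; noncomm_ring
    calc ‖Ω * S - 1‖ ≤ ‖Y‖ * ‖Y‖ ^ 2 + ‖Y‖ + ‖Y‖ ^ 2 := by
          rw [e]
          refine (norm_add₃_le).trans ?_
          gcongr
          refine (norm_mul_le _ _).trans ?_
          gcongr
      _ = ‖Y‖ * (‖Y‖ ^ 2 + 1 + ‖Y‖) := by ring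
      _ ≤ (3 / 2 * κ) * (4 / 3) := by
          gcongr
          nlinarith [norm_nonneg Y]
      _ = 2 * κ := by ring

end IsDiagonalization

end

/-! ### The commutant and the unitary groups -/

section

variable {E : Type*} [NormedAddCommGroup E] [InnerProductSpace ℂ E]

theorem mem_addBounded_graph_iff {H : E →ₗ.[ℂ] E} {B : E →L[ℂ] E} {ψ φ : E} :
    (ψ, φ) ∈ (addBounded H B).graph ↔ (ψ, φ - B ψ) ∈ H.graph := by
  rw [LinearPMap.mem_graph_iff, LinearPMap.mem_graph_iff]
  constructor
  · rintro ⟨x, hx, hφ⟩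
    refine ⟨x, hx, ?_⟩
    simp only at hx hφ ⊢
    rw [← hφ, ← hx]
    change H x = H x + B x - B x
    abel
  · rintro ⟨x, hx, hφ⟩
    refine ⟨x, hx, ?_⟩
    simp only at hx hφ ⊢
    change H x + B x = φ
    rw [hφ, hx, sub_add_cancel]

theorem hasDerivAt_clm_apply_zero {G : ℝ → (E →L[ℂ] E)} {G' : E →L[ℂ] E} {f : ℝ → E} {f' : E}
    (hG : HasDerivAt G G' 0) (hf : HasDerivAt f f' 0) :
    HasDerivAt (fun t => G t (f t)) (G' (f 0) + G 0 f') 0 := by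
  have h1 := (ContinuousLinearMap.restrictScalarsL ℂ E E ℝ ℝ).hasFDerivAt.comp_hasDerivAt (0 : ℝ) hG
  exact h1.clm_apply hf

variable [CompleteSpace E]

/-- An operator that commutes with the projections onto the eigenspaces leaves every spectral
subspace and its orthogonal complement invariant. -/
theorem mem_commutant {H : E →ₗ.[ℂ] E} {P : eigenvalues H → (E →L[ℂ] E)}
    (hP : IsResolution P)
    (hfix : ∀ (i : eigenvalues H) ψ, ψ ∈ eigenspace H i ↔ P i ψ = ψ) {S : E →L[ℂ] E}
    (hS : ∀ i, Commute S (P i)) : S ∈ commutant H := by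
  intro Ω _
  set K := (⨆ h ∈ Ω, eigenspace H h).topologicalClosure with hK
  have hinv : ∀ {S : E →L[ℂ] E}, (∀ i, Commute S (P i)) → ∀ x ∈ K, S x ∈ K := by
    intro S hS
    have h1 : (⨆ h ∈ Ω, eigenspace H h) ≤ K.comap (S : E →ₗ[ℂ] E) := by
      refine iSup₂_le fun k hk x hx => Submodule.le_topologicalClosure _ ?_
      refine (le_iSup₂ (f := fun h (_ : h ∈ Ω) => eigenspace H h) k hk) ?_
      by_cases hke : k ∈ eigenvalues H
      · refine (hfix ⟨k, hke⟩ _).2 ?_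
        have h2 := DFunLike.congr_fun (hS ⟨k, hke⟩).eq x
        rw [mul_apply_eq_comp, mul_apply_eq_comp, (hfix ⟨k, hke⟩ x).1 hx] at h2
        exact h2.symm
      · rw [eigenvalues, Set.mem_ofPred_eq, not_not] at hke
        rw [hke, Submodule.mem_bot] at hx
        rw [hx]
        simp
    have h2 : IsClosed (K.comap (S : E →ₗ[ℂ] E) : Set E) :=
      (Submodule.isClosed_topologicalClosure _).preimage S.continuous
    exact fun x hx => Submodule.topologicalClosure_minimal _ h1 h2 hx
  have hS' : ∀ i, Commute (star S) (P i) := fun i => by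
    have := (hS i).star_star
    rwa [(hP.isSelfAdjoint i).star_eq] at this
  ext ψ
  rw [mul_apply_eq_comp, mul_apply_eq_comp]
  change S (K.starProjection ψ) = K.starProjection (S ψ)
  symm
  refine Submodule.eq_starProjection_of_mem_of_inner_eq_zero
    (hinv hS _ (Submodule.starProjection_apply_mem _ _)) fun w hw => ?_
  rw [← map_sub, ← ContinuousLinearMap.adjoint_inner_right, ← ContinuousLinearMap.star_eq_adjoint]
  exact Submodule.starProjection_inner_eq_zero ψ _ (hinv hS' w hw)

namespace IsDiagonalization

variable {ι : Type*} {H : E →ₗ.[ℂ] E} {h : ι → ℝ} {P : ι → (E →L[ℂ] E)}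

/-- The unitary group `e^{-itH} = ∑ᵢ e^{-ith(i)} Pᵢ`. For the generator, both sides of
`U(t) ψ = ψ - i ∫₀ᵗ U(s) H ψ ds` have the same components. -/
theorem exists_isEvolution (D : IsDiagonalization H h P) :
    ∃ U : ℝ → (E →L[ℂ] E), IsEvolution H U ∧
      ∀ S : E →L[ℂ] E, (∀ i, Commute S (P i)) → ∀ t, Commute S (U t) := by
  set f : ℝ → ι → ℂ := fun t i => Complex.exp (t * (-(Complex.I * h i))) with hf
  have hf1 : ∀ t i, ‖f t i‖ ≤ 1 := fun t i => by
    have : (t * (-(Complex.I * h i)) : ℂ) = ((-(t * h i) : ℝ) : ℂ) * Complex.I := by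
      push_cast; ring
    simp only [hf]
    rw [this, Complex.norm_exp_ofReal_mul_I]
  have hff : ∀ t i, star (f t i) * f t i = 1 := fun t i => by
    simp only [hf]
    rw [Complex.star_def, ← Complex.exp_conj, ← Complex.exp_add]
    simp
  choose U hU hU' using fun t => D.exists_diagonal (f t) zero_le_one (hf1 t)
  have hUa : ∀ t i ψ, P i (U t ψ) = f t i • P i ψ := fun t i ψ => DFunLike.congr_fun (hU t i) ψ
  have hUs : ∀ t i ψ, P i (star (U t) ψ) = star (f t i) • P i ψ := fun t i ψ => by
    have := congrArg star (hU' t i)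
    rw [star_mul, star_smul, (D.isSelfAdjoint i).star_eq] at this
    exact DFunLike.congr_fun this ψ
  have hunit : ∀ t, U t ∈ unitary (E →L[ℂ] E) := fun t => by
    rw [Unitary.mem_iff]
    constructor <;> refine ContinuousLinearMap.ext fun ψ => D.ext_apply fun i => ?_
    · rw [mul_apply_eq_comp, hUs, hUa, smul_smul, hff, one_smul, one_apply_eq_self]
    · rw [mul_apply_eq_comp, hUa, hUs, smul_smul, mul_comm, hff, one_smul, one_apply_eq_self]
  have hzero : U 0 = 1 := ContinuousLinearMap.ext fun ψ => D.ext_apply fun i => by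
    rw [hUa]; simp [hf]
  have hadd : ∀ s t, U (s + t) = U s * U t := fun s t =>
    ContinuousLinearMap.ext fun ψ => D.ext_apply fun i => by
      rw [mul_apply_eq_comp, hUa, hUa, hUa, smul_smul]
      congr 1
      simp only [hf]
      rw [← Complex.exp_add]
      push_cast
      ring_nf
  have hnorm : ∀ t ψ, ‖U t ψ‖ ≤ ‖ψ‖ := fun t ψ => by
    have h1 := D.hasSum_norm_sq (U t ψ)
    refine le_of_sq_le_sq ?_ (norm_nonneg _)
    refine hasSum_le (fun i => ?_) h1 (D.hasSum_norm_sq ψ)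
    rw [hUa, norm_smul, mul_pow]
    exact mul_le_of_le_one_left (by positivity) (pow_le_one₀ (norm_nonneg _) (hf1 t i))
  have hcont : ∀ ψ, Continuous fun t => U t ψ := by
    intro ψ
    have hu : TendstoUniformly (fun (F : Finset ι) t => U t (∑ i ∈ F, P i ψ))
        (fun t => U t ψ) Filter.atTop := by
      rw [Metric.tendstoUniformly_iff]
      intro ε hε
      filter_upwards [Metric.tendsto_nhds.1 (D.hasSum ψ) ε hε] with F hF t
      rw [dist_eq_norm, ← map_sub]
      refine (hnorm t _).trans_lt ?_
      rwa [← dist_eq_norm, dist_comm]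
    refine hu.continuous (Filter.Eventually.frequently (Filter.Eventually.of_forall fun F => ?_))
    simp only [map_sum]
    refine continuous_finsetSum _ fun i _ => ?_
    have : (fun t => U t (P i ψ)) = fun t => f t i • P i ψ := by
      funext t
      exact DFunLike.congr_fun (hU' t i) ψ
    rw [this]
    fun_prop
  have hderiv : ∀ i t, HasDerivAt (fun t => f t i) (f t i * (-(Complex.I * h i))) t := fun i t => by
    have h1 : HasDerivAt (fun t : ℝ => (t : ℂ) * (-(Complex.I * h i))) (-(Complex.I * h i)) t := by
      simpa using (Complex.ofRealCLM.hasDerivAt (x := t)).mul_const (-(Complex.I * h i))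
    exact h1.cexp
  refine ⟨U, ⟨hunit, hzero, hadd, hcont, fun ψ φ => ?_⟩, fun S hS t => ?_⟩
  · rw [D.mem_graph_iff]
    constructor
    · intro hg
      have hint : ∀ t, U t ψ = ψ + ∫ s in (0 : ℝ)..t, -(Complex.I • U s φ) := by
        intro t
        refine D.ext_apply fun i => ?_
        have hc : Continuous fun s => -(Complex.I • U s φ) := ((hcont φ).const_smul _).neg
        rw [map_add, ← ContinuousLinearMap.intervalIntegral_comp_comm _ (hc.intervalIntegrable 0 t),
          hUa]
        have h1 : ∀ s, HasDerivAt (fun s => f s i • P i ψ) (P i (-(Complex.I • U s φ))) s := by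
          intro s
          convert (hderiv i s).smul_const (P i ψ) using 1
          rw [map_neg, map_smul, hUa, hg, smul_smul, smul_smul, ← neg_smul]
          congr 1
          ring
        rw [intervalIntegral.integral_eq_sub_of_hasDerivAt (fun s _ => h1 s)
          (((P i).continuous.comp hc).intervalIntegrable 0 t)]
        simp [hf]
      have hc : Continuous fun s => -(Complex.I • U s φ) := ((hcont φ).const_smul _).neg
      have h2 := (hc.integral_hasStrictDerivAt 0 0).hasDerivAt.const_add ψ
      rw [hzero, one_apply_eq_self] at h2
      exact h2.congr_of_eventuallyEq (Filter.Eventually.of_forall hint)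
    · intro hd i
      have h1 := ((P i).restrictScalars ℝ).hasFDerivAt.comp_hasDerivAt (0 : ℝ) hd
      have h2 := (hderiv i 0).smul_const (P i ψ)
      have h3 : (fun t => f t i • P i ψ) = (P i).restrictScalars ℝ ∘ fun t => U t ψ :=
        funext fun t => (hUa t i ψ).symm
      rw [h3] at h2
      have h4 := h1.unique h2
      have h5 : f 0 i = 1 := by simp [hf]
      rw [h5, one_mul, ContinuousLinearMap.coe_restrictScalars', map_neg, map_smul, neg_smul,
        neg_inj, mul_smul] at h4
      exact smul_right_injective E Complex.I_ne_zero h4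
  · refine ContinuousLinearMap.ext fun ψ => D.ext_apply fun i => ?_
    have h1 : ∀ χ, P i (S χ) = S (P i χ) := fun χ => (DFunLike.congr_fun (hS i).eq χ).symm
    rw [mul_apply_eq_comp, mul_apply_eq_comp, h1, hUa, hUa, h1, map_smul]

end IsDiagonalization

/-- If the self-adjoint bounded operator `B` commutes with `e^{-itH}`, then
`e^{-it(H + B)} = e^{-itB} e^{-itH}`. -/
theorem IsEvolution.addBounded_of_commute {H : E →ₗ.[ℂ] E} {U : ℝ → (E →L[ℂ] E)}
    (hU : IsEvolution H U) {B : E →L[ℂ] E} (hB : IsSelfAdjoint B) (hBU : ∀ t, Commute B (U t)) :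
    ∃ U', IsEvolution (addBounded H B) U' := by
  let _ : NormedAlgebra ℚ (E →L[ℂ] E) := NormedAlgebra.restrictScalars ℚ ℂ _
  set G : ℝ → (E →L[ℂ] E) := fun t => NormedSpace.exp (t • (-(Complex.I • B))) with hG
  have hG0 : G 0 = 1 := by simp [hG]
  have hGadd : ∀ s t, G (s + t) = G s * G t := fun s t => by
    simp only [hG]
    rw [add_smul, NormedSpace.exp_add_of_commute]
    exact ((Commute.refl _).smul_left s).smul_right t
  have hGunit : ∀ t, G t ∈ unitary (E →L[ℂ] E) := fun t => by
    have hsk : t • (-(Complex.I • B)) ∈ skewAdjoint (E →L[ℂ] E) := by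
      rw [skewAdjoint.mem_iff]
      simp [star_smul, hB.star_eq]
    exact NormedSpace.exp_mem_unitary_of_mem_skewAdjoint hsk
  have hGd : HasDerivAt G (-(Complex.I • B)) 0 := by
    have := hasDerivAt_exp_smul_const (-(Complex.I • B)) (0 : ℝ)
    rwa [zero_smul, NormedSpace.exp_zero, one_mul] at this
  have hGc : Continuous G := by
    simp only [hG]
    exact NormedSpace.exp_continuous.comp (by fun_prop)
  have hGU : ∀ s t, Commute (G s) (U t) := fun s t => by
    refine Commute.exp_left ?_
    exact (((hBU t).smul_left Complex.I).neg_left).smul_left s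
  refine ⟨fun t => G t * U t, ⟨fun t => mul_mem (hGunit t) (hU.mem_unitary t), ?_, ?_, ?_, ?_⟩⟩
  · simp only [hG0, hU.map_zero, one_mul]
  · intro s t
    rw [hGadd, hU.map_add, mul_assoc, ← mul_assoc (G t), (hGU t s).eq]
    simp only [mul_assoc]
  · intro ψ
    exact hGc.clm_apply (hU.continuous ψ)
  · intro ψ φ
    rw [mem_addBounded_graph_iff, hU.generator]
    constructor
    · intro hd
      refine (hasDerivAt_clm_apply_zero hGd hd).congr_deriv ?_
      rw [hG0, hU.map_zero, one_apply_eq_self, one_apply_eq_self, neg_apply, smul_apply, smul_sub]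
      abel
    · intro hd
      -- `e^{-itH} ψ = e^{itB} (e^{-itB} e^{-itH} ψ)`
      have hGd' : HasDerivAt (fun t => G (-t)) (Complex.I • B) 0 := by
        have h1 : HasDerivAt G (-(Complex.I • B)) (-0) := by rwa [neg_zero]
        have h2 := h1.scomp 0 (hasDerivAt_neg 0)
        rwa [neg_smul, one_smul, neg_neg] at h2
      have h2 := hasDerivAt_clm_apply_zero hGd' hd
      have h3 : (fun t => G (-t) ((G t * U t) ψ)) = fun t => U t ψ := by
        funext t
        rw [← mul_apply_eq_comp, ← mul_assoc, ← hGadd, neg_add_cancel, hG0, one_mul]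
      rw [h3] at h2
      convert h2 using 1
      rw [neg_zero, hG0, hU.map_zero, one_mul, one_apply_eq_self, one_apply_eq_self, smul_apply,
        smul_sub]
      abel

theorem IsEvolution.conj {A A' : E →ₗ.[ℂ] E} {U : ℝ → (E →L[ℂ] E)} (hU : IsEvolution A U)
    {W : E →L[ℂ] E} (hW : W ∈ unitary (E →L[ℂ] E))
    (hA : ∀ ψ φ, (ψ, φ) ∈ A'.graph ↔ (star W ψ, star W φ) ∈ A.graph) :
    IsEvolution A' (fun t => W * U t * star W) := by
  have hW1 := (Unitary.mem_iff.1 hW).1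
  have hW2 := (Unitary.mem_iff.1 hW).2
  refine ⟨fun t => mul_mem (mul_mem hW (hU.mem_unitary t)) (Unitary.star_mem hW), ?_, ?_, ?_, ?_⟩
  · rw [hU.map_zero, mul_one, hW2]
  · intro s t
    calc W * U (s + t) * star W = W * U s * 1 * U t * star W := by
          rw [hU.map_add, mul_one]; simp only [mul_assoc]
      _ = _ := by rw [← hW1]; simp only [mul_assoc]
  · intro ψ
    exact W.continuous.comp (hU.continuous (star W ψ))
  · intro ψ φ
    rw [hA, hU.generator]
    constructor
    · intro hd
      have := (W.restrictScalars ℝ).hasFDerivAt.comp_hasDerivAt (0 : ℝ) hd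
      refine this.congr_deriv ?_
      rw [ContinuousLinearMap.coe_restrictScalars', map_neg, map_smul, ← mul_apply_eq_comp, hW2,
        one_apply_eq_self]
    · intro hd
      have := ((star W).restrictScalars ℝ).hasFDerivAt.comp_hasDerivAt (0 : ℝ) hd
      have h1 : (star W).restrictScalars ℝ ∘ (fun t => (W * U t * star W) ψ) =
          fun t => U t (star W ψ) := by
        funext t
        change (star W * W) (U t (star W ψ)) = _
        rw [hW1, one_apply_eq_self]
      rw [h1] at this
      refine this.congr_deriv ?_
      rw [ContinuousLinearMap.coe_restrictScalars', map_neg, map_smul]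

theorem norm_conj_sub_le {A : Type*} [NormedRing A] [StarRing A] [CStarRing A] {U W : A}
    (hU : U ∈ unitary A) (hW : W ∈ unitary A) : ‖W * U * star W - U‖ ≤ 2 * ‖W - 1‖ := by
  have e : W * U * star W - U = (W - 1) * (U * star W) + U * star (W - 1) := by
    rw [star_sub, star_one]; noncomm_ring
  rw [e]
  refine (norm_add_le _ _).trans_eq ?_
  rw [CStarRing.norm_mul_mem_unitary _ (mul_mem hU (Unitary.star_mem hW)),
    CStarRing.norm_mem_unitary_mul _ hU, norm_star]
  ring

theorem mem_addBounded_graph_iff_of_hasCommutator {ι : Type*} {H : E →ₗ.[ℂ] E} {h : ι → ℝ}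
    {P : ι → (E →L[ℂ] E)} (D : IsDiagonalization H h P) {V B W : E →L[ℂ] E}
    (hV : IsSelfAdjoint V) (hB : IsSelfAdjoint B) (hW : W ∈ unitary (E →L[ℂ] E))
    (hWH : HasCommutator H W (W * B - V * W)) (ψ φ : E) :
    (ψ, φ) ∈ (addBounded H V).graph ↔ (star W ψ, star W φ) ∈ (addBounded H B).graph := by
  have hW2 : ∀ χ, W (star W χ) = χ := fun χ => by
    rw [← mul_apply_eq_comp, (Unitary.mem_iff.1 hW).2, one_apply_eq_self]
  rw [mem_addBounded_graph_iff, mem_addBounded_graph_iff]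
  constructor
  · intro hg
    convert D.hasCommutator_star hWH _ _ hg using 2
    rw [star_sub, star_mul, star_mul, hV.star_eq, hB.star_eq, map_sub, neg_apply, sub_apply,
      mul_apply_eq_comp, mul_apply_eq_comp]
    abel
  · intro hg
    convert hWH _ _ hg using 2
    · rw [hW2]
    · rw [sub_apply, mul_apply_eq_comp, mul_apply_eq_comp, map_sub, hW2, hW2]
      abel

end

/-! ### The constants -/

section

/-- For `α < 2` already `(α + 1) (2 / α) > 3`. -/
theorem two_le_constAlpha : 2 ≤ constAlpha := by
  obtain ⟨h0, h⟩ := constAlpha_spec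
  by_contra hlt
  rw [not_le] at hlt
  have h1 : 2 / constAlpha ≤ Real.exp (2 / constAlpha) - 1 := by
    have := Real.add_one_le_exp (2 / constAlpha)
    linarith
  have h2 : (constAlpha + 1) * (2 / constAlpha) ≤ 3 :=
    (mul_le_mul_of_nonneg_left h1 (by positivity)).trans_eq h
  have h3 : (constAlpha + 1) * (2 / constAlpha) = 2 + 2 / constAlpha := by field_simp
  have h4 : 1 < 2 / constAlpha := by rwa [lt_div_iff₀ h0, one_mul]
  linarith

theorem four_pi_div_sqrt_three_le : 4 * (Real.pi / √3) ≤ constBeta / 2 := by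
  have h0 := constAlpha_spec.1
  have h1 : 1 / (2 * constAlpha) ≤ Real.exp (1 / (2 * constAlpha)) - 1 := by
    have := Real.add_one_le_exp (1 / (2 * constAlpha))
    linarith
  calc 4 * (Real.pi / √3) = 16 * Real.pi * constAlpha / √3 * (1 / (2 * constAlpha)) / 2 := by
        field_simp
        norm_num
    _ ≤ _ := by
        rw [constBeta]
        gcongr

theorem constRho_pos : 0 < constRho := by
  have h0 := constAlpha_spec.1
  rw [constRho]
  positivity

theorem eight_mul_pi_div_sqrt_three_le : 8 * (Real.pi / √3) ≤ constRho := by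
  have h0 := two_le_constAlpha
  calc 8 * (Real.pi / √3) = 4 * Real.pi * 2 / √3 := by ring
    _ ≤ _ := by
        rw [constRho]
        gcongr

/-! ### The approximation theorem -/

variable {E : Type*} [NormedAddCommGroup E] [InnerProductSpace ℂ E]

theorem le_abs_sub_of_mem_eigenvalues (H : E →ₗ.[ℂ] E) {i j : eigenvalues H} (hij : i ≠ j) :
    spectralGap H ≤ ENNReal.ofReal |(i : ℝ) - j| :=
  iInf₂_le_of_le (i : ℝ) i.2 <| iInf₂_le_of_le (j : ℝ) j.2 <|
    iInf_le_of_le (fun e => hij (Subtype.ext e)) le_rfl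

variable [CompleteSpace E]

theorem IsDiagonalization.exists_isEvolution_addBounded {ι : Type*} {H : E →ₗ.[ℂ] E} {h : ι → ℝ}
    {P : ι → (E →L[ℂ] E)} (D : IsDiagonalization H h P) {B : E →L[ℂ] E} (hB : IsSelfAdjoint B)
    (hBc : ∀ i, Commute B (P i)) : ∃ U, IsEvolution (addBounded H B) U := by
  obtain ⟨U₀, hU₀, hc⟩ := D.exists_isEvolution
  exact hU₀.addBounded_of_commute hB (hc B hBc)

/-- Conjugation by a unitary `W` moves `e^{-it(H + B)}` by at most `2 ‖W - 1‖`, uniformly in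
time. -/
theorem IsDiagonalization.exists_evolutions {ι : Type*} {H : E →ₗ.[ℂ] E} {h : ι → ℝ}
    {P : ι → (E →L[ℂ] E)} (D : IsDiagonalization H h P) {V B W : E →L[ℂ] E}
    (hV : IsSelfAdjoint V) (hB : IsSelfAdjoint B) (hBc : ∀ i, Commute B (P i))
    (hW : W ∈ unitary (E →L[ℂ] E)) (hWH : HasCommutator H W (W * B - V * W)) :
    ∃ U U' : ℝ → (E →L[ℂ] E), IsEvolution (addBounded H V) U ∧ IsEvolution (addBounded H B) U' ∧
      ∀ t, ‖U t - U' t‖ ≤ 2 * ‖W - 1‖ := by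
  obtain ⟨U', hU'⟩ := D.exists_isEvolution_addBounded hB hBc
  exact ⟨_, U', hU'.conj hW (mem_addBounded_graph_iff_of_hasCommutator D hV hB hW hWH), hU',
    fun t => norm_conj_sub_le (hU'.mem_unitary t) hW⟩

theorem isSelfAdjoint_real_smul (r : ℝ) {B : E →L[ℂ] E} (hB : IsSelfAdjoint B) :
    IsSelfAdjoint ((r : ℂ) • B) := by
  rw [isSelfAdjoint_iff, star_smul, hB.star_eq, Complex.star_def, Complex.conj_ofReal]

end

end EternalApprox

theorem mainTheorem2 {E : Type*} [NormedAddCommGroup E] [InnerProductSpace ℂ E] [CompleteSpace E]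
    (H : E →ₗ.[ℂ] E) (hH : IsSelfAdjoint H)
    (hpp : EternalApprox.HasPurePointSpectrum H)
    (η : ℝ≥0∞) (hη : η = EternalApprox.spectralGap H) (hη_pos : 0 < η)
    (V : Set.Icc (0 : ℝ) 1 → (E →L[ℂ] E)) (hV : ∀ ε, IsSelfAdjoint (V ε))
    (v : ℝ≥0∞) (hv : v = EternalApprox.uniformBound V) (hv_fin : v < ∞) :
    ∃ Vhat : Set.Icc (0 : ℝ) 1 → (E →L[ℂ] E),
      (∀ ε, IsSelfAdjoint (Vhat ε) ∧ Vhat ε ∈ EternalApprox.commutant H) ∧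
      ∀ ε : Set.Icc (0 : ℝ) 1,
        ENNReal.ofReal (ε : ℝ) ≤ η / (v * ENNReal.ofReal EternalApprox.constRho) →
        ∃ U Uhat : ℝ → (E →L[ℂ] E),
          EternalApprox.IsEvolution
            (EternalApprox.addBounded H (((ε : ℝ) : ℂ) • V ε)) U ∧
          EternalApprox.IsEvolution
            (EternalApprox.addBounded H (((ε : ℝ) : ℂ) • Vhat ε)) Uhat ∧
          ∀ t : ℝ, ‖U t - Uhat t‖ₑ ≤
            ENNReal.ofReal (EternalApprox.constBeta / 2) * (v / η) * ENNReal.ofReal (ε : ℝ) := by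
  obtain ⟨P, D, hfix⟩ := EternalApprox.exists_isDiagonalization hH hpp
  have key : ∀ ε : Set.Icc (0 : ℝ) 1, ∃ B : E →L[ℂ] E, IsSelfAdjoint B ∧ (∀ i, Commute B (P i)) ∧
      (ENNReal.ofReal (ε : ℝ) ≤ η / (v * ENNReal.ofReal EternalApprox.constRho) →
        ∃ U Uhat : ℝ → (E →L[ℂ] E),
          EternalApprox.IsEvolution (EternalApprox.addBounded H (((ε : ℝ) : ℂ) • V ε)) U ∧
          EternalApprox.IsEvolution (EternalApprox.addBounded H (((ε : ℝ) : ℂ) • B)) Uhat ∧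
          ∀ t : ℝ, ‖U t - Uhat t‖ₑ ≤
            ENNReal.ofReal (EternalApprox.constBeta / 2) * (v / η) * ENNReal.ofReal (ε : ℝ)) := by
    intro ε
    by_cases hVc : ∀ i, Commute (V ε) (P i)
    · -- This covers `η = ∞`, where `H` has at most one eigenvalue.
      refine ⟨V ε, hV ε, hVc, fun _ => ?_⟩
      obtain ⟨U, hU⟩ := D.exists_isEvolution_addBounded
        (EternalApprox.isSelfAdjoint_real_smul ε (hV ε)) fun i => (hVc i).smul_left _
      exact ⟨U, U, hU, hU, fun t => by rw [sub_self, enorm_zero]; exact zero_le⟩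
    have hη_fin : η ≠ ∞ := by
      intro htop
      refine hVc fun i => ?_
      refine D.commute_of_offDiagonal_eq_zero (fun j k hjk => ?_) i
      have := EternalApprox.le_abs_sub_of_mem_eigenvalues H hjk
      rw [← hη, htop, top_le_iff] at this
      exact (ENNReal.ofReal_ne_top this).elim
    rcases ε.2.1.eq_or_lt with hε0 | hε0
    · -- The block-diagonal operator found for `ε V` is divided by `ε`, so `ε = 0` is separate.
      refine ⟨0, IsSelfAdjoint.zero _, fun i => Commute.zero_left _, fun _ => ?_⟩
      rw [← hε0, Complex.ofReal_zero, zero_smul, zero_smul]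
      obtain ⟨U, hU⟩ := D.exists_isEvolution_addBounded
        (IsSelfAdjoint.zero (E →L[ℂ] E)) fun i => Commute.zero_left _
      exact ⟨U, U, hU, hU, fun t => by rw [sub_self, enorm_zero]; exact zero_le⟩
    by_cases hε : ENNReal.ofReal (ε : ℝ) ≤ η / (v * ENNReal.ofReal EternalApprox.constRho)
    swap
    · exact ⟨0, IsSelfAdjoint.zero _, fun i => Commute.zero_left _, fun h => (hε h).elim⟩
    lift η to NNReal using hη_fin with δ
    lift v to NNReal using hv_fin.ne with w
    have hδ : (0 : ℝ) < δ := by exact_mod_cast hη_pos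
    have hsep : ∀ i j : EternalApprox.eigenvalues H, i ≠ j → (δ : ℝ) ≤ |(i : ℝ) - j| :=
      fun i j hij => by
        have := EternalApprox.le_abs_sub_of_mem_eigenvalues H hij
        rw [← hη] at this
        exact (ENNReal.le_ofReal_iff_toReal_le ENNReal.coe_ne_top (abs_nonneg _)).1 this
    have hVw : ‖V ε‖ ≤ w := by
      have : ‖V ε‖ₑ ≤ w := by
        rw [hv]
        exact le_iSup (fun ε => ‖V ε‖ₑ) ε
      exact_mod_cast this
    have hρ := EternalApprox.constRho_pos
    have hεδ : (ε : ℝ) * (w * EternalApprox.constRho) ≤ δ := by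
      have h1 := ENNReal.mul_le_of_le_div hε
      have h2 := ENNReal.toReal_mono ENNReal.coe_ne_top h1
      simpa [ENNReal.toReal_ofReal, hε0.le, hρ.le] using h2
    have hnorm : ‖((ε : ℝ) : ℂ) • V ε‖ ≤ ε * w := by
      rw [norm_smul, Complex.norm_real, Real.norm_of_nonneg hε0.le]
      gcongr
    have hκ : Real.pi / (√3 * δ) * ‖((ε : ℝ) : ℂ) • V ε‖ ≤ 1 / 8 := by
      have h8 := EternalApprox.eight_mul_pi_div_sqrt_three_le
      calc Real.pi / (√3 * δ) * ‖((ε : ℝ) : ℂ) • V ε‖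
          ≤ Real.pi / (√3 * δ) * (ε * w) := by gcongr
        _ = 8 * (Real.pi / √3) * (ε * w) / (8 * δ) := by field_simp
        _ ≤ EternalApprox.constRho * (ε * w) / (8 * δ) := by gcongr
        _ = ε * (w * EternalApprox.constRho) / (8 * δ) := by ring
        _ ≤ δ / (8 * δ) := by gcongr
        _ = 1 / 8 := by field_simp
    obtain ⟨W, B, hW, hB, hBc, hWH, hW1⟩ := D.exists_unitary_blockDiagonal hδ hsep
      (EternalApprox.isSelfAdjoint_real_smul ε (hV ε)) hκ
    refine ⟨(((ε : ℝ)⁻¹ : ℝ) : ℂ) • B, EternalApprox.isSelfAdjoint_real_smul _ hB,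
      fun i => (hBc i).smul_left _, fun _ => ?_⟩
    rw [smul_smul, ← Complex.ofReal_mul, mul_inv_cancel₀ hε0.ne', Complex.ofReal_one, one_smul]
    obtain ⟨U, U', hU, hU', h⟩ := D.exists_evolutions
      (EternalApprox.isSelfAdjoint_real_smul ε (hV ε)) hB hBc hW hWH
    refine ⟨U, U', hU, hU', fun t => ?_⟩
    have hβ := EternalApprox.four_pi_div_sqrt_three_le
    have hreal : ‖U t - U' t‖ ≤ EternalApprox.constBeta / 2 * (w / δ) * ε := by
      calc ‖U t - U' t‖ ≤ 2 * (2 * (Real.pi / (√3 * δ) * (ε * w))) := by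
            refine (h t).trans ?_
            gcongr
            refine hW1.trans ?_
            gcongr
        _ = 4 * (Real.pi / √3) * (w / δ) * ε := by field_simp; ring
        _ ≤ _ := by gcongr
    have hβ0 : 0 ≤ EternalApprox.constBeta / 2 := le_trans (by positivity) hβ
    rw [← ofReal_norm]
    refine (ENNReal.ofReal_le_ofReal hreal).trans_eq ?_
    rw [ENNReal.ofReal_mul (by positivity), ENNReal.ofReal_mul hβ0, ENNReal.ofReal_div_of_pos hδ,
      ENNReal.ofReal_coe_nnreal, ENNReal.ofReal_coe_nnreal]
  choose B hB hBc hU using key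
  exact ⟨B, fun ε => ⟨hB ε, EternalApprox.mem_commutant D.toIsResolution hfix (hBc ε)⟩, hU⟩
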